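/- Let $n\ge 0$ and let $s=(s(1),\dots,s(n))$ be a sequence of non-negative integers. An $s$-decreasing tree is a planar rooted tree whose internal vertices are labeled bijectively by $1,\dots,n$ (leaves are unlabeled), such that vertex $i$ has $s(i)+1$ ordered children, indexed $0,\dots,s(i)$, and all labeled proper descendants of $i$ have labels smaller than $i$. Write $T^y_i$ for the full subtree of $T$ rooted at the $i$-th child of $y$. For $x<y$ put $\#_T(y,x)=i$ if $x\in T^y_i$, $\#_T(y,x)=0$ if $x$ is left of $y$, and $\#_T(y,x)=s(y)$ if $x$ is right of $y$. Let $\mathrm{inv}(T)$ be the multiset of pairs $(y,x)$, $x<y$, with multiplicities $\#_T(y,x)$. The $s$-weak order is defined by $T\preceq Z$ if and only if $\mathrm{inv}(T)\subseteq\mathrm{inv}(Z)$, i.e. $\#_T(y,x)\le\#_Z(y,x)$ for all $x<y$. An $s$-Tamari tree is an $s$-decreasing tree $T$ with $\#_T(c,a)\le\#_T(c,b)$ for all $a<b<c$; the $s$-Tamari lattice is the set of $s$-Tamari trees with the induced order, and $\lessdot$ denotes its cover relation. A Tamari tree ascent of $T$ is a pair $(a,b)$ such that $a$ is a child of $b$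 in $T$, but not the rightmost ($s(b)$-th) one. For such a pair, the $s$-Tamari rotation of $T$ along $(a,b)$ is the $s$-Tamari tree $Z$ with $\mathrm{inv}(Z)=(\mathrm{inv}(T)+(b,a))^{tc}$. Here $\mathrm{inv}(T)+(b,a)$ raises the multiplicity of $(b,a)$ by one (truncated at $s(b)$). Further, $I^{tc}$ is the smallest multiset $J\supseteq I$ of pairs $(y,x)$ with $x<y$ that is transitive: for all $a<b<c$, the multiplicity of $(b,a)$ in $J$ is $0$, or the multiplicity of $(c,a)$ in $J$ is at least that of $(c,b)$. An SB-labeling of a finite lattice $L$ is a labeling $\lambda$ of its cover relations such that for all $u,v,w\in L$ with $v\ne w$ both covering $u$: (i) $\lambda(u,v)\ne\lambda(u,w)$; (ii) each saturated chain from $u$ to $v\vee w$ uses each of the labels $\lambda(u,v)$ and $\lambda(u,w)$ at least once; (iii) no saturated chain from $u$ to $v\vee w$ uses any other label. **Theorem.** The $s$-Tamari lattice is a (nonempty) finite lattice. For each cover relation $T\lessdot Z$ in it there is a unique Tamari tree ascent $(a,b)$ of $T$ such that $Z$ is the $s$-Tamari rotation of $T$ along $(a,b)$. The edge labeling $\lambda(T,Z)=a$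 so defined is an SB-labeling of the $s$-Tamari lattice. Moreover, for all $s$-Tamari trees $T,Z,Q$ with $T\lessdot Z$, $T\lessdot Q$ and $Z\neq Q$, the Hasse diagram of the closed interval $[T,Z\vee Q]$ of the $s$-Tamari lattice is a diamond (its elements are $T,Z\vee Q$ and two distinct elements, each covering $T$ and covered by $Z\vee Q$) or a pentagon (it consists of two maximal chains $T\lessdot X\lessdot Z\vee Q$ and $T\lessdot Y\lessdot P\lessdot Z\vee Q$ meeting only in their endpoints). -/

import Mathlib

/-- A planar rooted tree whose internal vertices carry labels in `Fin n`; an internal vertex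
labeled `a` has exactly `s a + 1` ordered children, indexed by `0, …, s a`. Leaves are unlabeled.
(The label `i : Fin n` stands for the label `i + 1` of `{1, …, n}`.) -/
inductive LTree {n : ℕ} (s : Fin n → ℕ) : Type
  | leaf : LTree s
  | node (a : Fin n) (c : Fin (s a + 1) → LTree s) : LTree s

namespace LTree

variable {n : ℕ} {s : Fin n → ℕ}

/-- The multiset of labels of the internal vertices. -/
def labels : LTree s → Multiset (Fin n)
  | leaf => 0
  | node a c => a ::ₘ ∑ i, (c i).labels

/-- Every labeled proper descendant of a vertex `a` has a label smaller than `a`. -/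
def Decreasing : LTree s → Prop
  | leaf => True
  | node a c => ∀ i, (∀ x ∈ (c i).labels, x < a) ∧ (c i).Decreasing

/-- `T.InSub y i x`: the vertex `x` lies in the full subtree `T^y_i` rooted at the `i`-th child
of the vertex `y`. -/
def InSub : LTree s → Fin n → ℕ → Fin n → Prop
  | leaf, _, _, _ => False
  | node a c, y, i, x =>
      ∃ j : Fin (s a + 1), (a = y ∧ (j : ℕ) = i ∧ x ∈ (c j).labels) ∨ (c j).InSub y i x

/-- The root of the tree is the internal vertex labeled `a`. -/
def HasRoot : LTree s → Fin n → Prop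
  | leaf, _ => False
  | node r _, a => r = a

/-- `T.IsChild b i a`: the `i`-th child of the vertex `b` is the internal vertex `a`. -/
def IsChild : LTree s → Fin n → ℕ → Fin n → Prop
  | leaf, _, _, _ => False
  | node r c, b, i, a =>
      ∃ j : Fin (s r + 1), (r = b ∧ (j : ℕ) = i ∧ (c j).HasRoot a) ∨ (c j).IsChild b i a

/-- `x` is right of `y`: they lie below two different children of a common vertex, with the child
above `x` having the larger index. -/
def RightOf (T : LTree s) (x y : Fin n) : Prop :=
  ∃ v i j, i < j ∧ T.InSub v i y ∧ T.InSub v j x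

open Classical in
/-- The cardinality `#_T(y, x)`: it is `i` if `x` lies in `T^y_i` (for a tree with distinct labels
there is at most one such `i`); otherwise it is `s y` if `x` is right of `y`, and `0` if not,
that is, if `x` is left of `y`. -/
noncomputable def card (T : LTree s) (y x : Fin n) : ℕ :=
  if ∃ i, T.InSub y i x then sInf {i | T.InSub y i x}
  else if T.RightOf x y then s y else 0

/-- The multiplicities of the multi-set `inv(T)` of tree inversions: the pair `(y, x)` has
multiplicity `#_T(y, x)` for `x < y`; other pairs do not occur. -/
noncomputable def inv (T : LTree s) (y x : Fin n) : ℕ :=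
  if x < y then T.card y x else 0

theorem mem_labels_node {a : Fin n} {c : Fin (s a + 1) → LTree s} {x : Fin n} :
    x ∈ (node a c).labels ↔ x = a ∨ ∃ i, x ∈ (c i).labels := by
  simp [labels, Multiset.mem_sum]

theorem InSub.mem {T : LTree s} {y x : Fin n} {i : ℕ} (h : T.InSub y i x) :
    y ∈ T.labels ∧ x ∈ T.labels := by
  induction T with
  | leaf => exact h.elim
  | node a c ih =>
    obtain ⟨j, ⟨h1, -, h3⟩ | h⟩ := h
    · exact ⟨mem_labels_node.2 (Or.inl h1.symm), mem_labels_node.2 (Or.inr ⟨j, h3⟩)⟩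
    · exact ⟨mem_labels_node.2 (Or.inr ⟨j, (ih j h).1⟩),
        mem_labels_node.2 (Or.inr ⟨j, (ih j h).2⟩)⟩

theorem nodup_child {a : Fin n} {c : Fin (s a + 1) → LTree s} (h : (node a c).labels.Nodup)
    (i : Fin (s a + 1)) : (c i).labels.Nodup := by
  refine Multiset.nodup_of_le ?_ (Multiset.nodup_cons.1 h).2
  exact Finset.single_le_sum (f := fun i => (c i).labels) (fun _ _ => Multiset.zero_le _)
    (Finset.mem_univ i)

theorem root_notMem_child {a : Fin n} {c : Fin (s a + 1) → LTree s}
    (h : (node a c).labels.Nodup) (i : Fin (s a + 1)) : a ∉ (c i).labels := fun hi =>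
  (Multiset.nodup_cons.1 h).1 (Multiset.mem_sum.2 ⟨i, Finset.mem_univ i, hi⟩)

theorem child_unique {a : Fin n} {c : Fin (s a + 1) → LTree s} (h : (node a c).labels.Nodup)
    {i j : Fin (s a + 1)} {x : Fin n} (hi : x ∈ (c i).labels) (hj : x ∈ (c j).labels) :
    i = j := by
  by_contra hij
  have h1 : (c i).labels + (c j).labels ≤ ∑ i, (c i).labels := by
    rw [← Finset.sum_pair (f := fun i => (c i).labels) hij]
    exact Finset.sum_le_sum_of_subset (Finset.subset_univ _)
  have h2 := Multiset.nodup_of_le h1 (Multiset.nodup_cons.1 h).2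
  exact Multiset.disjoint_left.1 (Multiset.nodup_add.1 h2).2.2 hi hj

theorem inSub_root {a : Fin n} {c : Fin (s a + 1) → LTree s} (h : (node a c).labels.Nodup)
    {k : ℕ} {x : Fin n} : (node a c).InSub a k x ↔ ∃ j : Fin (s a + 1), (j : ℕ) = k ∧ x ∈ (c j).labels := by
  constructor
  · rintro ⟨j, ⟨-, h2, h3⟩ | h'⟩
    · exact ⟨j, h2, h3⟩
    · exact (root_notMem_child h j h'.mem.1).elim
  · rintro ⟨j, h2, h3⟩
    exact ⟨j, Or.inl ⟨rfl, h2, h3⟩⟩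

theorem inSub_child {a : Fin n} {c : Fin (s a + 1) → LTree s} (h : (node a c).labels.Nodup)
    {i : Fin (s a + 1)} {y x : Fin n} {k : ℕ} (hy : y ≠ a) (hx : x ∈ (c i).labels) :
    (node a c).InSub y k x ↔ (c i).InSub y k x := by
  constructor
  · rintro ⟨j, ⟨h1, -, -⟩ | h'⟩
    · exact (hy h1.symm).elim
    · rwa [child_unique h hx h'.mem.2]
  · exact fun h' => ⟨i, Or.inr h'⟩

theorem rightOf_child {a : Fin n} {c : Fin (s a + 1) → LTree s} (h : (node a c).labels.Nodup)
    {i : Fin (s a + 1)} {y x : Fin n} (hy : y ∈ (c i).labels) (hx : x ∈ (c i).labels) :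
    (node a c).RightOf x y ↔ (c i).RightOf x y := by
  constructor
  · rintro ⟨v, k, l, hkl, h1, h2⟩
    by_cases hv : v = a
    · subst hv
      obtain ⟨j, rfl, hj⟩ := (inSub_root h).1 h1
      obtain ⟨j', rfl, hj'⟩ := (inSub_root h).1 h2
      rw [child_unique h hj hy, child_unique h hj' hx] at hkl
      exact (lt_irrefl _ hkl).elim
    · exact ⟨v, k, l, hkl, (inSub_child h hv hy).1 h1, (inSub_child h hv hx).1 h2⟩
  · rintro ⟨v, k, l, hkl, h1, h2⟩
    exact ⟨v, k, l, hkl, ⟨i, Or.inr h1⟩, ⟨i, Or.inr h2⟩⟩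

theorem card_root {a : Fin n} {c : Fin (s a + 1) → LTree s} (h : (node a c).labels.Nodup)
    {i : Fin (s a + 1)} {x : Fin n} (hx : x ∈ (c i).labels) : (node a c).card a x = i := by
  have h1 : {k | (node a c).InSub a k x} = {(i : ℕ)} := by
    ext k
    change (node a c).InSub a k x ↔ k = (i : ℕ)
    rw [inSub_root h]
    constructor
    · rintro ⟨j, rfl, hj⟩
      rw [child_unique h hj hx]
    · rintro rfl
      exact ⟨i, rfl, hx⟩
  have h2 : ∃ k, (node a c).InSub a k x := ⟨i, (inSub_root h).2 ⟨i, rfl, hx⟩⟩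
  rw [card, if_pos h2, h1, csInf_singleton]

theorem card_child {a : Fin n} {c : Fin (s a + 1) → LTree s} (h : (node a c).labels.Nodup)
    {i : Fin (s a + 1)} {y x : Fin n} (hy : y ∈ (c i).labels) (hx : x ∈ (c i).labels) :
    (node a c).card y x = (c i).card y x := by
  classical
  have hya : y ≠ a := fun e => root_notMem_child h i (e ▸ hy)
  have h1 : ∀ k, (node a c).InSub y k x ↔ (c i).InSub y k x := fun k => inSub_child h hya hx
  have h2 : {k | (node a c).InSub y k x} = {k | (c i).InSub y k x} := Set.ext h1
  unfold card
  rw [h2]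
  exact if_congr (exists_congr h1) rfl (if_congr (rightOf_child h hy hx) rfl rfl)

theorem eq_of_inv_eq {T T' : LTree s} (hn : T.labels.Nodup) (hl : T.labels = T'.labels)
    (hd : T.Decreasing) (hd' : T'.Decreasing)
    (hc : ∀ y ∈ T.labels, ∀ x ∈ T.labels, x < y → T.card y x = T'.card y x) : T = T' := by
  induction T generalizing T' with
  | leaf =>
    cases T' with
    | leaf => rfl
    | node a c => simp [labels] at hl
  | node a c ih =>
    cases T' with
    | leaf => simp [labels] at hl
    | node a' c' =>
      have hle : ∀ {b : Fin n} {e : Fin (s b + 1) → LTree s}, (node b e).Decreasing →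
          ∀ x ∈ (node b e).labels, x ≤ b := by
        intro b e hb x hx
        rcases mem_labels_node.1 hx with rfl | ⟨i, hi⟩
        · exact le_rfl
        · exact ((hb i).1 x hi).le
      have haa : a = a' := by
        apply le_antisymm
        · exact hle hd' a (hl ▸ mem_labels_node.2 (Or.inl rfl))
        · exact hle hd a' (hl ▸ mem_labels_node.2 (Or.inl rfl))
      subst haa
      have hn' : (node a c').labels.Nodup := hl ▸ hn
      have hroot : ∀ i j x, x ∈ (c i).labels → x ∈ (c' j).labels → i = j := by
        intro i j x hi hj
        have h1 := hc a (mem_labels_node.2 (Or.inl rfl)) x (mem_labels_node.2 (Or.inr ⟨i, hi⟩))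
          ((hd i).1 x hi)
        rw [card_root hn hi, card_root hn' hj] at h1
        exact Fin.ext h1
      have hlab : ∀ i, (c i).labels = (c' i).labels := by
        intro i
        refine (Multiset.Nodup.ext (nodup_child hn i) (nodup_child hn' i)).2 fun x => ?_
        constructor
        · intro hx
          have h1 : x ∈ (node a c').labels := hl ▸ mem_labels_node.2 (Or.inr ⟨i, hx⟩)
          rcases mem_labels_node.1 h1 with rfl | ⟨j, hj⟩
          · exact (root_notMem_child hn i hx).elim
          · rwa [hroot i j x hx hj]
        · intro hx
          have h1 : x ∈ (node a c).labels := hl ▸ mem_labels_node.2 (Or.inr ⟨i, hx⟩)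
          rcases mem_labels_node.1 h1 with rfl | ⟨j, hj⟩
          · exact (root_notMem_child hn' i hx).elim
          · rwa [← hroot j i x hj hx]
      congr 1
      funext i
      refine ih i (nodup_child hn i) (hlab i) (hd i).2 (hd' i).2 fun y hy x hx hxy => ?_
      have h1 := hc y (mem_labels_node.2 (Or.inr ⟨i, hy⟩)) x (mem_labels_node.2 (Or.inr ⟨i, hx⟩))
        hxy
      rwa [card_child hn hy hx, card_child hn' (hlab i ▸ hy) (hlab i ▸ hx)] at h1

end LTree

/-- An `s`-decreasing tree: each label in `Fin n` occurs exactly once, and labels decrease from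
the root. -/
structure SDecTree {n : ℕ} (s : Fin n → ℕ) where
  tree : LTree s
  labels_eq : tree.labels = Finset.univ.val
  decreasing : tree.Decreasing

namespace SDecTree

variable {n : ℕ} {s : Fin n → ℕ}

/-- The multiplicity function of the multi-set of tree inversions of an `s`-decreasing tree. -/
noncomputable def inv (T : SDecTree s) : Fin n → Fin n → ℕ := T.tree.inv

theorem inv_injective : Function.Injective (inv : SDecTree s → Fin n → Fin n → ℕ) := by
  rintro ⟨T, hl, hd⟩ ⟨T', hl', hd'⟩ h
  have : T = T' := by
    refine LTree.eq_of_inv_eq (hl ▸ Finset.univ.nodup) (hl.trans hl'.symm) hd hd' ?_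
    intro y _ x _ hxy
    have h1 := congrFun (congrFun h y) x
    simpa [inv, LTree.inv, hxy] using h1
  subst this
  rfl

/-- The `s`-weak order: `T ≤ Z` if and only if `inv(T) ⊆ inv(Z)`, that is,
`#_T(y, x) ≤ #_Z(y, x)` for all `x < y`. -/
noncomputable instance : PartialOrder (SDecTree s) := PartialOrder.lift inv inv_injective

/-- `T` is an `s`-Tamari tree. -/
def IsTamari (T : SDecTree s) : Prop :=
  ∀ a b c : Fin n, a < b → b < c → T.inv c a ≤ T.inv c b

end SDecTree

/-- The `s`-Tamari trees, ordered by the restriction of the `s`-weak order. -/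
abbrev TamariTree {n : ℕ} (s : Fin n → ℕ) : Type := {T : SDecTree s // T.IsTamari}

/-- A multi-inversion set is given by its multiplicities `I y x`; only pairs `(y, x)` with `x < y`
occur. Inclusion is the pointwise order. -/
def IsMultiInv {n : ℕ} (I : Fin n → Fin n → ℕ) : Prop :=
  ∀ y x, I y x ≠ 0 → x < y

/-- Transitivity of a multi-inversion set. -/
def IsTransInv {n : ℕ} (I : Fin n → Fin n → ℕ) : Prop :=
  ∀ a b c : Fin n, a < b → b < c → I b a = 0 ∨ I c b ≤ I c a

/-- The sum `I + (b, a)`, truncated by `s`. -/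
def addInv {n : ℕ} (s : Fin n → ℕ) (I : Fin n → Fin n → ℕ) (b a : Fin n) : Fin n → Fin n → ℕ :=
  fun y x => min (I y x + if y = b ∧ x = a then 1 else 0) (s y)

/-- `J` is the transitive closure `I^{tc}`: the smallest transitive multi-inversion set
containing `I`. -/
def IsTransClosure {n : ℕ} (I J : Fin n → Fin n → ℕ) : Prop :=
  IsLeast {K | IsMultiInv K ∧ IsTransInv K ∧ I ≤ K} J

namespace TamariTree

variable {n : ℕ} {s : Fin n → ℕ}

/-- `(a, b)` is a Tamari tree ascent of `T`: `a` is a child of `b`, but not the rightmost one. -/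
def IsAscent (T : TamariTree s) (a b : Fin n) : Prop :=
  ∃ i < s b, T.1.tree.IsChild b i a

/-- `(a, b)` is a Tamari tree ascent of `T`, and `Z` is the `s`-Tamari rotation of `T`
along `(a, b)`: `inv(Z) = (inv(T) + (b, a))^{tc}`. -/
def IsRotation (T Z : TamariTree s) (a b : Fin n) : Prop :=
  IsAscent T a b ∧ IsTransClosure (addInv s T.1.inv b a) Z.1.inv

end TamariTree

/-- A (nonempty) finite lattice, as a property of a partial order. -/
structure IsFiniteLattice (L : Type*) [PartialOrder L] : Prop where
  nonempty : Nonempty L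
  finite : Finite L
  exists_join : ∀ x y : L, ∃ j, IsLUB {x, y} j
  exists_meet : ∀ x y : L, ∃ m, IsGLB {x, y} m

/-- An edge labeling: a label for each cover relation `x ⋖ y`. -/
def EdgeLabeling (L Λ : Type*) [PartialOrder L] := ∀ x y : L, x ⋖ y → Λ

/-- An SB-labeling of a finite lattice. Here `v` and `w` are distinct elements covering `u`, `j` is
their join, and `c 0 ⋖ c 1 ⋖ … ⋖ c k` runs through the saturated chains from `u` to `j`. -/
structure IsSBLabeling {L Λ : Type*} [PartialOrder L] (lab : EdgeLabeling L Λ) : Prop where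
  finiteLattice : IsFiniteLattice L
  label_ne : ∀ (u v w : L) (hv : u ⋖ v) (hw : u ⋖ w), v ≠ w → lab u v hv ≠ lab u w hw
  uses_both : ∀ (u v w : L) (hv : u ⋖ v) (hw : u ⋖ w), v ≠ w → ∀ j, IsLUB {v, w} j →
    ∀ (k : ℕ) (c : ℕ → L) (hc : ∀ i, i < k → c i ⋖ c (i + 1)), c 0 = u → c k = j →
      (∃ i, ∃ hi : i < k, lab _ _ (hc i hi) = lab u v hv) ∧
      (∃ i, ∃ hi : i < k, lab _ _ (hc i hi) = lab u w hw)
  uses_only : ∀ (u v w : L) (hv : u ⋖ v) (hw : u ⋖ w), v ≠ w → ∀ j, IsLUB {v, w} j →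
    ∀ (k : ℕ) (c : ℕ → L) (hc : ∀ i, i < k → c i ⋖ c (i + 1)), c 0 = u → c k = j →
      ∀ i, ∀ hi : i < k, lab _ _ (hc i hi) = lab u v hv ∨ lab _ _ (hc i hi) = lab u w hw

/-- The closed interval `[x, y]` is a diamond: besides `x` and `y` it has exactly two elements,
each covering `x` and covered by `y`. -/
def IsDiamond {L : Type*} [PartialOrder L] (x y : L) : Prop :=
  ∃ p q : L, p ≠ q ∧ Set.Icc x y = {x, p, q, y} ∧ x ⋖ p ∧ p ⋖ y ∧ x ⋖ q ∧ q ⋖ y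

/-- The closed interval `[x, y]` is a pentagon: its Hasse diagram consists of two maximal chains
`x ⋖ p ⋖ y` and `x ⋖ q ⋖ r ⋖ y` which meet only in `x` and `y`. -/
def IsPentagon {L : Type*} [PartialOrder L] (x y : L) : Prop :=
  ∃ p q r : L, p ≠ q ∧ p ≠ r ∧ Set.Icc x y = {x, p, q, r, y} ∧
    x ⋖ p ∧ p ⋖ y ∧ x ⋖ q ∧ q ⋖ r ∧ r ⋖ y

/-! ### Multiplicities in decreasing trees -/

namespace LTree

variable {n : ℕ} {s : Fin n → ℕ}

/-! A Tamari tree is encoded by its multiplicities `I y x` (row `y`, column `x`). The functions that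
occur are exactly those of `IsTamariInv`: bounded by `s`, increasing along each row, and with `I c a
= I c b` whenever `I b a ≠ 0`. A pointwise minimum keeps these properties, so meets are pointwise;
as there is a top element, joins exist too (`exists_isGLB`, `exists_isTop`).

In this encoding a rotation along `(a, b)` changes row `b` only: it raises by one the entries at `a`
and at the `x` with `I a x ≠ 0`, all of which had the value `I b a`. If `T ≤ K` and `K` exceeds `T`
at a single one of these entries, then `K` lies above the whole rotation
(`IsRotation.le_of_inv_lt`). Hence rotations are covers. Every cover is a rotation, because the
largest column and then the largest row where two comparable trees differ form an ascent
(`exists_isInvAscent_lt`). The label `a` is the largest column that changes.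

Let `u` be rotated along `(a, b)` and `(a', b')` with `a < a'`. Unless `b = a'` and `I b a = 0`, the
pointwise maximum of the two results is again Tamari (`isTamariInv_max`), and the interval is a
diamond. In the exceptional case `a` sits in child 0 of `b`, and rotating `b` leaves `a` behind. An
extra rotation with label `a` must fetch it, which gives the pentagon. The labels along all chains
are then read off. -/

theorem card_eq_of_lt {r : Fin n} {c : Fin (s r + 1) → LTree s} (h : (node r c).labels.Nodup)
    {i j : Fin (s r + 1)} {y x : Fin n} (hy : y ∈ (c i).labels) (hx : x ∈ (c j).labels)
    (hij : i < j) : (node r c).card y x = s y := by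
  have h1 : ¬ ∃ k, (node r c).InSub y k x := by
    rintro ⟨k, l, ⟨rfl, -, -⟩ | h'⟩
    · exact root_notMem_child h i hy
    · have h2 := child_unique h hy h'.mem.1
      have h3 := child_unique h hx h'.mem.2
      exact hij.ne (h2.trans h3.symm)
  have h2 : (node r c).RightOf x y :=
    ⟨r, i, j, hij, (inSub_root h).2 ⟨i, rfl, hy⟩, (inSub_root h).2 ⟨j, rfl, hx⟩⟩
  rw [card, if_neg h1, if_pos h2]

theorem card_eq_zero_of_gt {r : Fin n} {c : Fin (s r + 1) → LTree s}
    (h : (node r c).labels.Nodup) {i j : Fin (s r + 1)} {y x : Fin n} (hy : y ∈ (c i).labels)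
    (hx : x ∈ (c j).labels) (hij : j < i) : (node r c).card y x = 0 := by
  have h1 : ¬ ∃ k, (node r c).InSub y k x := by
    rintro ⟨k, l, ⟨rfl, -, -⟩ | h'⟩
    · exact root_notMem_child h i hy
    · have h2 := child_unique h hy h'.mem.1
      have h3 := child_unique h hx h'.mem.2
      exact hij.ne (h3.trans h2.symm)
  have h2 : ¬ (node r c).RightOf x y := by
    rintro ⟨v, k, l, hkl, h1, h2⟩
    by_cases hv : v = r
    · subst hv
      obtain ⟨i', rfl, hi'⟩ := (inSub_root h).1 h1
      obtain ⟨j', rfl, hj'⟩ := (inSub_root h).1 h2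
      rw [child_unique h hi' hy, child_unique h hj' hx] at hkl
      exact absurd hij (not_lt_of_gt hkl)
    · exact hij.ne (child_unique h ((inSub_child h hv hx).1 h2).mem.1
        ((inSub_child h hv hy).1 h1).mem.1)
  rw [card, if_neg h1, if_neg h2]

theorem card_eq_card_of_sibling {r : Fin n} {c : Fin (s r + 1) → LTree s}
    (h : (node r c).labels.Nodup) {i j : Fin (s r + 1)} {y x x' : Fin n}
    (hy : y ∈ (c i).labels) (hx : x ∈ (c j).labels) (hx' : x' ∈ (c j).labels) (hij : i ≠ j) :
    (node r c).card y x = (node r c).card y x' := by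
  rcases lt_or_gt_of_ne hij with h' | h'
  · rw [card_eq_of_lt h hy hx h', card_eq_of_lt h hy hx' h']
  · rw [card_eq_zero_of_gt h hy hx h', card_eq_zero_of_gt h hy hx' h']

theorem InSub.le {T : LTree s} {y x : Fin n} {i : ℕ} (h : T.InSub y i x) : i ≤ s y := by
  induction T with
  | leaf => exact h.elim
  | node a c ih =>
    obtain ⟨j, ⟨rfl, rfl, -⟩ | h⟩ := h
    · exact Nat.lt_succ_iff.1 j.2
    · exact ih j h

theorem card_le (T : LTree s) (y x : Fin n) : T.card y x ≤ s y := by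
  unfold card
  split_ifs with h1 h2
  · exact (Nat.sInf_mem h1 : T.InSub y _ x).le
  · exact le_rfl
  · exact Nat.zero_le _

/-- The Tamari condition for a tree whose labels form an arbitrary set. -/
def TamariOn (T : LTree s) : Prop :=
  ∀ a ∈ T.labels, ∀ b ∈ T.labels, ∀ c ∈ T.labels, a < b → b < c → T.card c a ≤ T.card c b

theorem mem_node_of_mem_child {r : Fin n} {c : Fin (s r + 1) → LTree s} {i : Fin (s r + 1)}
    {x : Fin n} (hx : x ∈ (c i).labels) : x ∈ (node r c).labels :=
  mem_labels_node.2 (Or.inr ⟨i, hx⟩)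

theorem mem_node_root {r : Fin n} {c : Fin (s r + 1) → LTree s} : r ∈ (node r c).labels :=
  mem_labels_node.2 (Or.inl rfl)

theorem Decreasing.le_root {r : Fin n} {c : Fin (s r + 1) → LTree s}
    (hd : (node r c).Decreasing) {x : Fin n} (hx : x ∈ (node r c).labels) : x ≤ r := by
  rcases mem_labels_node.1 hx with rfl | ⟨i, hi⟩
  · exact le_rfl
  · exact ((hd i).1 x hi).le

theorem TamariOn.child {r : Fin n} {c : Fin (s r + 1) → LTree s} (h : (node r c).labels.Nodup)
    (ht : (node r c).TamariOn) (i : Fin (s r + 1)) : (c i).TamariOn := by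
  intro x hx y hy z hz hxy hyz
  rw [← card_child h hz hx, ← card_child h hz hy]
  exact ht x (mem_node_of_mem_child hx) y (mem_node_of_mem_child hy) z
    (mem_node_of_mem_child hz) hxy hyz

theorem TamariOn.index_le {r : Fin n} {c : Fin (s r + 1) → LTree s}
    (h : (node r c).labels.Nodup) (hd : (node r c).Decreasing) (ht : (node r c).TamariOn)
    {i j : Fin (s r + 1)} {x y : Fin n} (hx : x ∈ (c i).labels) (hy : y ∈ (c j).labels)
    (hxy : x < y) : i ≤ j := by
  have h1 := ht x (mem_node_of_mem_child hx) y (mem_node_of_mem_child hy) r mem_node_root hxy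
    ((hd j).1 y hy)
  rw [card_root h hx, card_root h hy] at h1
  exact h1

/-- At a root above both, the Tamari condition forbids `x` to lie in a later child than `y`, and an
earlier child would give multiplicity 0. So `x` and `y` share a child; a vertex `z` outside it
cannot tell them apart, and for `z` inside it the argument recurses. -/
theorem TamariOn.card_eq {T : LTree s} (hn : T.labels.Nodup) (hd : T.Decreasing)
    (ht : T.TamariOn) {x y z : Fin n} (hx : x ∈ T.labels) (hy : y ∈ T.labels)
    (hz : z ∈ T.labels) (hxy : x < y) (hyz : y < z) (h0 : T.card y x ≠ 0) :
    T.card z x = T.card z y := by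
  induction T with
  | leaf => simp [labels] at hx
  | node r c ih =>
    have hzr := hd.le_root hz
    obtain ⟨j, hj⟩ := (mem_labels_node.1 hy).resolve_left (hyz.trans_le hzr).ne
    obtain ⟨i, hi⟩ := (mem_labels_node.1 hx).resolve_left (hxy.trans (hyz.trans_le hzr)).ne
    have hij : i = j := by
      refine (ht.index_le hn hd hi hj hxy).eq_of_not_lt fun hlt => h0 ?_
      exact card_eq_zero_of_gt hn hj hi hlt
    subst hij
    rcases mem_labels_node.1 hz with rfl | ⟨k, hk⟩
    · rw [card_root hn hi, card_root hn hj]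
    · by_cases hki : k = i
      · subst hki
        rw [card_child hn hk hi, card_child hn hk hj]
        rw [card_child hn hj hi] at h0
        exact ih k (nodup_child hn k) (hd k).2 (ht.child hn k) hi hj hk h0
      · exact card_eq_card_of_sibling hn hk hi hj hki

/-- `y` is larger than `x`, and no larger vertex of `T` separates `x` from `y`. In a Tamari tree
this says that `x` is a proper descendant of `y`. -/
def NotSeparated (T : LTree s) (y x : Fin n) : Prop :=
  x < y ∧ ∀ c ∈ T.labels, y < c → T.card c x = T.card c y

theorem HasRoot.mem {T : LTree s} {a : Fin n} (h : T.HasRoot a) : a ∈ T.labels := by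
  cases T with
  | leaf => exact h.elim
  | node r c => exact mem_labels_node.2 (Or.inl (Eq.symm h))

theorem HasRoot.le {T : LTree s} {a x : Fin n} (hd : T.Decreasing) (h : T.HasRoot a)
    (hx : x ∈ T.labels) : x ≤ a := by
  cases T with
  | leaf => exact h.elim
  | node r c =>
    have : r = a := h
    subst this
    exact hd.le_root hx

theorem exists_hasRoot {T : LTree s} {x : Fin n} (hx : x ∈ T.labels) : ∃ a, T.HasRoot a := by
  cases T with
  | leaf => simp [labels] at hx
  | node r c => exact ⟨r, rfl⟩

theorem IsChild.mem {T : LTree s} {a b : Fin n} {i : ℕ} (h : T.IsChild b i a) :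
    b ∈ T.labels ∧ a ∈ T.labels := by
  induction T with
  | leaf => exact h.elim
  | node r c ih =>
    obtain ⟨j, ⟨rfl, -, h3⟩ | h⟩ := h
    · exact ⟨mem_node_root, mem_node_of_mem_child h3.mem⟩
    · exact ⟨mem_node_of_mem_child (ih j h).1, mem_node_of_mem_child (ih j h).2⟩

theorem notSeparated_child {r : Fin n} {c : Fin (s r + 1) → LTree s}
    (h : (node r c).labels.Nodup) {i : Fin (s r + 1)} {x y : Fin n}
    (hx : x ∈ (c i).labels) (hy : y ∈ (c i).labels) :
    (node r c).NotSeparated y x ↔ (c i).NotSeparated y x := by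
  refine and_congr_right fun _ => ⟨fun h' z hz hyz => ?_, fun h' z hz hyz => ?_⟩
  · rw [← card_child h hz hx, ← card_child h hz hy]
    exact h' z (mem_node_of_mem_child hz) hyz
  · rcases mem_labels_node.1 hz with rfl | ⟨k, hk⟩
    · rw [card_root h hx, card_root h hy]
    · by_cases hki : k = i
      · subst hki
        rw [card_child h hk hx, card_child h hk hy]
        exact h' z hk hyz
      · exact card_eq_card_of_sibling h hk hx hy hki

theorem NotSeparated.index_eq {r : Fin n} {c : Fin (s r + 1) → LTree s}
    (h : (node r c).labels.Nodup) (hd : (node r c).Decreasing) {i j : Fin (s r + 1)}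
    {x y : Fin n} (hx : x ∈ (c i).labels) (hy : y ∈ (c j).labels)
    (hs : (node r c).NotSeparated y x) : i = j := by
  have h1 := hs.2 r mem_node_root ((hd j).1 y hy)
  rw [card_root h hx, card_root h hy] at h1
  exact Fin.ext h1

/-- The `y` with `NotSeparated y a` are the proper ancestors of `a`. Labels decrease downwards, so
the parent is the smallest of them. -/
theorem isChild_iff {T : LTree s} (hn : T.labels.Nodup) (hd : T.Decreasing) {a b : Fin n}
    (ha : a ∈ T.labels) (hb : b ∈ T.labels) {i : ℕ} :
    T.IsChild b i a ↔ T.card b a = i ∧ T.NotSeparated b a ∧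
      ∀ y ∈ T.labels, y < b → ¬ T.NotSeparated y a := by
  induction T with
  | leaf => simp [labels] at ha
  | node r c ih =>
    rcases mem_labels_node.1 ha with rfl | ⟨j, hj⟩
    · constructor
      · rintro ⟨k, ⟨-, -, h3⟩ | h⟩
        · exact (root_notMem_child hn k h3.mem).elim
        · exact (root_notMem_child hn k h.mem.2).elim
      · rintro ⟨-, h, -⟩
        exact absurd h.1 (not_lt_of_ge (hd.le_root hb))
    rcases mem_labels_node.1 hb with rfl | ⟨k, hk⟩
    · constructor
      · rintro ⟨k, ⟨-, rfl, h3⟩ | h⟩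
        · obtain rfl := child_unique hn hj h3.mem
          refine ⟨card_root hn hj, ⟨(hd j).1 a hj, fun z hz hlt =>
            absurd hlt (not_lt_of_ge (hd.le_root hz))⟩, fun y hy hyb hs => ?_⟩
          obtain ⟨l, hl⟩ := (mem_labels_node.1 hy).resolve_left hyb.ne
          obtain rfl := hs.index_eq hn hd hj hl
          exact absurd hs.1 (not_lt_of_ge (h3.le (hd j).2 hl))
        · exact (root_notMem_child hn k h.mem.1).elim
      · rintro ⟨rfl, -, h⟩
        -- If the root `y` of the child containing `a` were not `a`, it would be a smaller ancestor
        -- than `b`.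
        obtain ⟨y, hy⟩ := exists_hasRoot hj
        refine ⟨j, Or.inl ⟨rfl, (card_root hn hj).symm, ?_⟩⟩
        rcases (hy.le (hd j).2 hj).eq_or_lt with rfl | hlt
        · exact hy
        · refine (h y (mem_node_of_mem_child hy.mem) ((hd j).1 y hy.mem) ?_).elim
          rw [notSeparated_child hn hj hy.mem]
          exact ⟨hlt, fun z hz hyz => absurd hyz (not_lt_of_ge (hy.le (hd j).2 hz))⟩
    · have hbr : b ≠ r := fun e => root_notMem_child hn k (e ▸ hk)
      constructor
      · rintro ⟨l, ⟨h1, -, -⟩ | h⟩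
        · exact (hbr h1.symm).elim
        · obtain rfl := child_unique hn hj h.mem.2
          obtain rfl := child_unique hn hk h.mem.1
          obtain ⟨h1, h2, h3⟩ := (ih k (nodup_child hn k) (hd k).2 hj hk).1 h
          refine ⟨(card_child hn hk hj).trans h1, (notSeparated_child hn hj hk).2 h2,
            fun y hy hyb hs => ?_⟩
          obtain ⟨l, hl⟩ := (mem_labels_node.1 hy).resolve_left
            (hyb.trans ((hd k).1 b hk)).ne
          obtain rfl := hs.index_eq hn hd hj hl
          exact h3 y hl hyb ((notSeparated_child hn hj hl).1 hs)
      · rintro ⟨h1, h2, h3⟩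
        obtain rfl := h2.index_eq hn hd hj hk
        refine ⟨j, Or.inr ((ih j (nodup_child hn j) (hd j).2 hj hk).2
          ⟨(card_child hn hk hj).symm.trans h1, (notSeparated_child hn hj hk).1 h2,
            fun y hy hyb hs => ?_⟩)⟩
        exact h3 y (mem_node_of_mem_child hy) hyb ((notSeparated_child hn hj hy).2 hs)

end LTree

/-- The multi-inversion sets of `s`-Tamari trees. -/
structure IsTamariInv {n : ℕ} (s : Fin n → ℕ) (I : Fin n → Fin n → ℕ) : Prop where
  isMultiInv : IsMultiInv I
  le : ∀ y x, I y x ≤ s y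
  mono : ∀ ⦃a b c : Fin n⦄, a < b → b < c → I c a ≤ I c b
  eq : ∀ ⦃a b c : Fin n⦄, a < b → b < c → I b a ≠ 0 → I c a = I c b

/-- `a < b` and `I` does not separate `a` from `b` at any `c > b`. For the inversion set of a
Tamari tree this says that `a` is a proper descendant of `b`. -/
def InvBelow {n : ℕ} (I : Fin n → Fin n → ℕ) (b a : Fin n) : Prop :=
  a < b ∧ ∀ c, b < c → I c a = I c b

/-- The description of Tamari tree ascents in terms of inversion sets. -/
structure IsInvAscent {n : ℕ} (s : Fin n → ℕ) (I : Fin n → Fin n → ℕ) (a b : Fin n) : Prop where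
  below : InvBelow I b a
  not_below : ∀ y, y < b → ¬ InvBelow I y a
  lt : I b a < s b

/-! ### Rebuilding a tree from its inversion set -/

namespace LTree

variable {n : ℕ} {s : Fin n → ℕ}

/-- The maximum `r` of `A` becomes the root, and `x` goes to child `I r x`. Arbitrary label sets are
needed because the children carry subsets of `A`. -/
theorem exists_card_eq {I : Fin n → Fin n → ℕ} (hI : IsTamariInv s I) (A : Finset (Fin n)) :
    ∃ T : LTree s, T.labels = A.val ∧ T.Decreasing ∧
      ∀ y ∈ A, ∀ x ∈ A, x < y → T.card y x = I y x := by
  induction A using Finset.strongInduction with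
  | H A ih =>
    rcases A.eq_empty_or_nonempty with rfl | hA
    · exact ⟨leaf, rfl, trivial, by simp⟩
    · set r := A.max' hA with hr
      have hrA : r ∈ A := A.max'_mem hA
      let B : Fin (s r + 1) → Finset (Fin n) := fun j => {x ∈ A.erase r | I r x = j}
      have hB : ∀ j x, x ∈ B j ↔ x ≠ r ∧ x ∈ A ∧ I r x = j := by
        intro j x
        simp [B, and_assoc]
      have hlt : ∀ j x, x ∈ B j → x < r := fun j x hx =>
        lt_of_le_of_ne (A.le_max' x ((hB j x).1 hx).2.1) ((hB j x).1 hx).1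
      have hsub : ∀ j, B j ⊂ A := fun j =>
        ⟨fun x hx => ((hB j x).1 hx).2.1, fun h => (lt_irrefl r) (hlt j r (h hrA))⟩
      choose c hc1 hc2 hc3 using fun j => ih (B j) (hsub j)
      have hmem : ∀ j x, x ∈ (c j).labels ↔ x ∈ B j := fun j x => by rw [hc1]; rfl
      have hlab : (node r c).labels = A.val := by
        have h1 : (node r c).labels.Nodup := by
          rw [labels, Multiset.nodup_cons]
          constructor
          · rw [Multiset.mem_sum]
            rintro ⟨j, -, hj⟩
            exact lt_irrefl r (hlt j r ((hmem j r).1 hj))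
          · have hdis : (↑(Finset.univ : Finset (Fin (s r + 1))) : Set _).PairwiseDisjoint B := by
              intro i _ j _ hij
              refine Finset.disjoint_left.2 fun x hi hj => hij (Fin.ext ?_)
              exact ((hB i x).1 hi).2.2.symm.trans ((hB j x).1 hj).2.2
            have h2 : (∑ j, (c j).labels) = (Finset.univ.disjiUnion B hdis).val := by
              simp only [hc1]
              rfl
            rw [h2]
            exact Finset.nodup _
        refine (Multiset.Nodup.ext h1 A.nodup).2 fun x => ?_
        rw [mem_labels_node]
        constructor
        · rintro (rfl | ⟨j, hj⟩)
          · exact hrA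
          · exact ((hB j x).1 ((hmem j x).1 hj)).2.1
        · intro hx
          by_cases hxr : x = r
          · exact Or.inl hxr
          · exact Or.inr ⟨⟨I r x, Nat.lt_succ_of_le (hI.le r x)⟩,
              (hmem _ x).2 ((hB _ x).2 ⟨hxr, hx, rfl⟩)⟩
      have hn : (node r c).labels.Nodup := hlab ▸ A.nodup
      have hloc : ∀ x ∈ A, x ≠ r → ∃ j : Fin (s r + 1), (j : ℕ) = I r x ∧ x ∈ (c j).labels :=
        fun x hx hxr => ⟨⟨I r x, Nat.lt_succ_of_le (hI.le r x)⟩, rfl,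
          (hmem _ x).2 ((hB _ x).2 ⟨hxr, hx, rfl⟩)⟩
      refine ⟨node r c, hlab, fun j => ⟨fun x hx => hlt j x ((hmem j x).1 hx), hc2 j⟩, ?_⟩
      intro y hy x hx hxy
      have hyr : y ≤ r := A.le_max' y hy
      obtain ⟨i, hi, hxi⟩ := hloc x hx (hxy.trans_le hyr).ne
      by_cases hyr' : y = r
      · subst hyr'
        rw [card_root hn hxi, hi]
      · obtain ⟨j, hj, hyj⟩ := hloc y hy hyr'
        have hyr := lt_of_le_of_ne hyr hyr'
        have hij : i ≤ j := by
          rw [Fin.le_def, hi, hj]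
          exact hI.mono hxy hyr
        rcases hij.eq_or_lt with rfl | hij
        · rw [card_child hn hyj hxi]
          exact hc3 i y ((hmem i y).1 hyj) x ((hmem i x).1 hxi) hxy
        -- Here `x` is left of `y`; a nonzero `I y x` would force `I r x = I r y`, hence the same
        -- child.
        · rw [card_eq_zero_of_gt hn hyj hxi hij]
          by_contra h0
          have := hI.eq hxy hyr (Ne.symm h0)
          rw [← hi, ← hj] at this
          exact hij.ne (Fin.ext this)

end LTree

/-! ### Dictionary between Tamari trees and inversion sets -/

namespace TamariTree

variable {n : ℕ} {s : Fin n → ℕ}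

theorem mem_labels (T : TamariTree s) (x : Fin n) : x ∈ T.1.tree.labels := by
  rw [T.1.labels_eq]
  exact Finset.mem_univ x

theorem nodup_labels (T : TamariTree s) : T.1.tree.labels.Nodup :=
  T.1.labels_eq ▸ Finset.univ.nodup

theorem inv_eq_card (T : TamariTree s) {y x : Fin n} (h : x < y) :
    T.1.inv y x = T.1.tree.card y x := if_pos h

theorem isTamariInv (T : TamariTree s) : IsTamariInv s T.1.inv where
  isMultiInv y x h := by
    by_contra hxy
    exact h (if_neg hxy)
  le y x := by
    by_cases hxy : x < y
    · rw [inv_eq_card T hxy]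
      exact LTree.card_le _ _ _
    · exact (if_neg hxy : T.1.inv y x = 0).trans_le (Nat.zero_le _)
  mono := T.2
  eq a b c hab hbc h := by
    rw [inv_eq_card T hab] at h
    rw [inv_eq_card T hbc, inv_eq_card T (hab.trans hbc)]
    refine LTree.TamariOn.card_eq T.nodup_labels T.1.decreasing ?_ (T.mem_labels a)
      (T.mem_labels b) (T.mem_labels c) hab hbc h
    intro x _ y _ z _ hxy hyz
    rw [← inv_eq_card T hyz, ← inv_eq_card T (hxy.trans hyz)]
    exact T.2 x y z hxy hyz

theorem exists_inv_eq {I : Fin n → Fin n → ℕ} (hI : IsTamariInv s I) :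
    ∃ T : TamariTree s, T.1.inv = I := by
  obtain ⟨T, h1, h2, h3⟩ := LTree.exists_card_eq hI Finset.univ
  have h4 : (SDecTree.mk T h1 h2).inv = I := by
    funext y x
    by_cases hxy : x < y
    · exact (if_pos hxy).trans (h3 y (Finset.mem_univ y) x (Finset.mem_univ x) hxy)
    · refine (if_neg hxy).trans ?_
      by_contra h0
      exact hxy (hI.isMultiInv y x (Ne.symm h0))
  exact ⟨⟨⟨T, h1, h2⟩, fun a b c hab hbc => by rw [h4]; exact hI.mono hab hbc⟩, h4⟩

theorem notSeparated_iff (T : TamariTree s) {a b : Fin n} :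
    T.1.tree.NotSeparated b a ↔ InvBelow T.1.inv b a := by
  refine and_congr_right fun hab => ⟨fun h c hc => ?_, fun h c _ hc => ?_⟩
  · rw [inv_eq_card T hc, inv_eq_card T (hab.trans hc)]
    exact h c (T.mem_labels c) hc
  · rw [← inv_eq_card T hc, ← inv_eq_card T (hab.trans hc)]
    exact h c hc

theorem isAscent_iff (T : TamariTree s) {a b : Fin n} :
    IsAscent T a b ↔ IsInvAscent s T.1.inv a b := by
  have key : ∀ i, T.1.tree.IsChild b i a ↔ _ := fun i =>
    LTree.isChild_iff T.nodup_labels T.1.decreasing (T.mem_labels a) (T.mem_labels b)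
  simp only [notSeparated_iff] at key
  constructor
  · rintro ⟨i, hi, h⟩
    obtain ⟨h1, h2, h3⟩ := (key i).1 h
    refine ⟨h2, fun y => h3 y (T.mem_labels y), ?_⟩
    rwa [inv_eq_card T h2.1, h1]
  · rintro ⟨h2, h3, h4⟩
    rw [inv_eq_card T h2.1] at h4
    exact ⟨_, h4, (key _).2 ⟨rfl, h2, fun y _ => h3 y⟩⟩

theorem le_iff {T Z : TamariTree s} : T ≤ Z ↔ ∀ y x, T.1.inv y x ≤ Z.1.inv y x := Iff.rfl

theorem ext_inv {T Z : TamariTree s} (h : T.1.inv = Z.1.inv) : T = Z :=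
  Subtype.ext (SDecTree.inv_injective h)

end TamariTree

/-! ### Rotations of inversion sets -/

section InversionSets

variable {n : ℕ} {s : Fin n → ℕ} {I K : Fin n → Fin n → ℕ} {a b a' b' x y : Fin n}

/-- The vertices `x` for which the multiplicity of `(b, x)` grows in a rotation along `(a, b)`. -/
abbrev InvMoved (I : Fin n → Fin n → ℕ) (a x : Fin n) : Prop := x = a ∨ I a x ≠ 0

/-- The inversion set of the rotation along an ascent `(a, b)`. -/
def invRot (I : Fin n → Fin n → ℕ) (a b : Fin n) : Fin n → Fin n → ℕ :=
  fun y x => if y = b ∧ InvMoved I a x then I b a + 1 else I y x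

theorem invRot_of_moved (hx : InvMoved I a x) : invRot I a b b x = I b a + 1 :=
  if_pos ⟨rfl, hx⟩

theorem invRot_of_not (h : ¬ (y = b ∧ InvMoved I a x)) : invRot I a b y x = I y x :=
  if_neg h

namespace IsTamariInv

theorem isTransInv (hI : IsTamariInv s I) : IsTransInv I := fun a b c hab hbc => by
  by_cases h : I b a = 0
  · exact Or.inl h
  · exact Or.inr (hI.eq hab hbc h).ge

theorem moved_le (hI : IsTamariInv s I) (h : InvMoved I a x) : x ≤ a := by
  rcases h with rfl | h
  · exact le_rfl
  · exact (hI.isMultiInv _ _ h).le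

theorem moved_eq (hI : IsTamariInv s I) (h : InvMoved I a x) {c : Fin n} (hc : a < c) :
    I c x = I c a := by
  rcases h with rfl | h
  · rfl
  · exact hI.eq (hI.isMultiInv _ _ h) hc h

end IsTamariInv

namespace IsInvAscent

/-- As a child of `b`, `a` is the largest label in its subtree, so a label between `a` and `b` lies
strictly further right as seen from `b`. The proof is a downward induction on `x`: equality would
put `a` below `x`, against `not_below`. -/
theorem lt_of_between (hI : IsTamariInv s I) (h : IsInvAscent s I a b) (hax : a < x)
    (hxb : x < b) : I b a < I b x := by
  refine lt_of_le_of_ne (hI.mono hax hxb) ?_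
  induction x using WellFoundedGT.induction with
  | ind x ih =>
    intro he
    refine h.not_below x hxb ⟨hax, fun c hc => ?_⟩
    rcases lt_trichotomy c b with hcb | rfl | hcb
    · refine (hI.mono hax hc).eq_of_not_lt fun hlt => ?_
      exact ih c hc (hax.trans hc) hcb
        (he.trans (hI.eq hc hcb (Nat.ne_of_gt (Nat.zero_lt_of_lt hlt))))
    · exact he
    · exact le_antisymm (hI.mono hax hc) ((hI.mono hxb hcb).trans (h.below.2 c hcb).ge)

theorem moved_below (hI : IsTamariInv s I) (h : IsInvAscent s I a b) (hx : InvMoved I a x)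
    {c : Fin n} (hc : b < c) : I c x = I c b :=
  (hI.moved_eq hx (h.below.1.trans hc)).trans (h.below.2 c hc)

theorem le_invRot (hI : IsTamariInv s I) (h : IsInvAscent s I a b) (y x : Fin n) :
    I y x ≤ invRot I a b y x := by
  by_cases hm : y = b ∧ InvMoved I a x
  · obtain ⟨rfl, hm⟩ := hm
    rw [invRot_of_moved hm, hI.moved_eq hm h.below.1]
    exact Nat.le_succ _
  · rw [invRot_of_not hm]

theorem lt_invRot_iff (hI : IsTamariInv s I) (h : IsInvAscent s I a b) :
    I y x < invRot I a b y x ↔ y = b ∧ InvMoved I a x := by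
  refine ⟨fun hlt => by_contra fun hm => ?_, ?_⟩
  · rw [invRot_of_not hm] at hlt
    exact lt_irrefl _ hlt
  · rintro ⟨rfl, hm⟩
    rw [invRot_of_moved hm, hI.moved_eq hm h.below.1]
    exact Nat.lt_succ_self _

/-- This keeps the condition `eq` valid in row `b` after the rotation: two columns forced to agree
there are raised together or not at all. -/
theorem moved_iff (hI : IsTamariInv s I) (h : IsInvAscent s I a b) (hxy : x < y) (hyb : y < b)
    (h0 : I y x ≠ 0) : InvMoved I a x ↔ InvMoved I a y := by
  rcases lt_trichotomy y a with hya | rfl | hya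
  · have := hI.eq hxy hya h0
    simp [InvMoved, this, hya.ne, (hxy.trans hya).ne]
  · simp [InvMoved, h0]
  · have h1 : ¬ InvMoved I a y := fun hm => absurd (hI.moved_le hm) (not_le_of_gt hya)
    have h2 : ¬ InvMoved I a x := fun hm => by
      have h3 := h.lt_of_between hI hya hyb
      rw [← hI.eq hxy hyb h0, hI.moved_eq hm h.below.1] at h3
      exact lt_irrefl _ h3
    exact iff_of_false h2 h1

theorem isTamariInv_invRot (hI : IsTamariInv s I) (h : IsInvAscent s I a b) :
    IsTamariInv s (invRot I a b) where
  isMultiInv y x h0 := by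
    by_cases hm : y = b ∧ InvMoved I a x
    · obtain ⟨rfl, hm⟩ := hm
      exact (hI.moved_le hm).trans_lt h.below.1
    · rw [invRot_of_not hm] at h0
      exact hI.isMultiInv y x h0
  le y x := by
    by_cases hm : y = b ∧ InvMoved I a x
    · obtain ⟨rfl, hm⟩ := hm
      rw [invRot_of_moved hm]
      exact h.lt
    · rw [invRot_of_not hm]
      exact hI.le y x
  mono x y z hxy hyz := by
    by_cases hm : z = b ∧ InvMoved I a x
    · obtain ⟨rfl, hm⟩ := hm
      rw [invRot_of_moved hm]
      rcases lt_trichotomy y a with hya | rfl | hya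
      · have h0 : I a x ≠ 0 := hm.resolve_left (hxy.trans hya).ne
        have h1 : InvMoved I a y :=
          Or.inr (Nat.ne_of_gt ((Nat.pos_of_ne_zero h0).trans_le (hI.mono hxy hya)))
        rw [invRot_of_moved h1]
      · rw [invRot_of_moved (Or.inl rfl)]
      -- The strict inequality of `lt_of_between` leaves room for the added one.
      · exact (Nat.succ_le_of_lt (h.lt_of_between hI hya hyz)).trans (h.le_invRot hI _ _)
    · rw [invRot_of_not hm]
      exact (hI.mono hxy hyz).trans (h.le_invRot hI _ _)
  eq x y z hxy hyz h0 := by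
    by_cases hm : y = b ∧ InvMoved I a x
    · obtain ⟨rfl, hm⟩ := hm
      rw [invRot_of_not (fun e => hyz.ne' e.1), invRot_of_not (fun e => hyz.ne' e.1)]
      exact h.moved_below hI hm hyz
    · rw [invRot_of_not hm] at h0
      have h1 := hI.eq hxy hyz h0
      by_cases hz : z = b
      · subst hz
        have h2 := h.moved_iff hI hxy hyz h0
        simp only [invRot, h2, h1]
      · rw [invRot_of_not (fun e => hz e.1), invRot_of_not (fun e => hz e.1), h1]

/-- For `I a x ≠ 0`, also `K a x ≠ 0`, and transitivity of `K` at `x < a < b` gives `K b a ≤ K b x`.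
This yields both the transitive closure and the covering property. -/
theorem invRot_le (hI : IsTamariInv s I) (h : IsInvAscent s I a b) (hK : IsTransInv K)
    (hIK : I ≤ K) (hlt : I b a < K b a) : invRot I a b ≤ K := by
  intro y x
  by_cases hm : y = b ∧ InvMoved I a x
  · obtain ⟨rfl, hm⟩ := hm
    rw [invRot_of_moved hm]
    rcases hm with rfl | h0
    · exact hlt
    · have h1 := hK x a y (hI.isMultiInv _ _ h0) h.below.1
      have h2 : I a x ≤ K a x := hIK a x
      exact hlt.trans_le (h1.resolve_left (by omega))
  · rw [invRot_of_not hm]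
    exact hIK y x

theorem isTransClosure_iff (hI : IsTamariInv s I) (h : IsInvAscent s I a b) :
    IsTransClosure (addInv s I b a) K ↔ K = invRot I a b := by
  have key : IsTransClosure (addInv s I b a) (invRot I a b) := by
    have hT := h.isTamariInv_invRot hI
    refine ⟨⟨hT.isMultiInv, hT.isTransInv, fun y x => ?_⟩, ?_⟩
    · by_cases hm : y = b ∧ x = a
      · obtain ⟨rfl, rfl⟩ := hm
        rw [invRot_of_moved (Or.inl rfl)]
        exact (min_le_left _ _).trans (by simp)
      · refine (min_le_left _ _).trans ?_
        rw [if_neg hm]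
        exact h.le_invRot hI y x
    · rintro L ⟨-, hL, hIL⟩
      refine h.invRot_le hI hL (fun y x => le_trans ?_ (hIL y x)) (lt_of_lt_of_le ?_ (hIL b a))
      · exact le_min (Nat.le_add_right _ _) (hI.le y x)
      -- The truncation at `s b` is inactive because `a` is not the rightmost child.
      · refine lt_min ?_ h.lt
        rw [if_pos ⟨rfl, rfl⟩]
        exact Nat.lt_succ_self _
  constructor
  · exact fun h' => IsLeast.unique h' key
  · rintro rfl
    exact key

end IsInvAscent

/-- Take the largest column `a` where `I` and `K` differ, and in it the largest row `b`. Above `b`,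
column `a` of `I` agrees with `K`, whose condition `eq` gives `below`. If `a` were below some `y <
b`, then `I b a = I b y = K b y ≥ K b a`, a contradiction. -/
theorem exists_isInvAscent_lt (hK : IsTamariInv s K) (hle : I ≤ K)
    (hne : I ≠ K) : ∃ a b, IsInvAscent s I a b ∧ I b a < K b a := by
  classical
  have h0 : ∃ b a, I b a < K b a := by
    by_contra! h
    exact hne (le_antisymm hle h)
  obtain ⟨b₀, a₀, h0⟩ := h0
  obtain ⟨a, ha, hamax⟩ := Finset.exists_max_image
    ({a | ∃ b, I b a < K b a} : Finset (Fin n)) id ⟨a₀, by simpa using ⟨b₀, h0⟩⟩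
  obtain ⟨b₁, h1⟩ : ∃ b, I b a < K b a := by simpa using ha
  obtain ⟨b, hb, hbmax⟩ := Finset.exists_max_image
    ({b | I b a < K b a} : Finset (Fin n)) id ⟨b₁, by simpa using h1⟩
  have hb : I b a < K b a := by simpa using hb
  have hbmax : ∀ c, b < c → I c a = K c a := fun c hc => (hle c a).eq_of_not_lt fun hlt =>
    absurd hc (not_lt_of_ge (hbmax c (by simpa using hlt)))
  have hamax : ∀ x, a < x → ∀ c, I c x = K c x := fun x hx c =>
    (hle c x).eq_of_not_lt fun hlt =>
      absurd hx (not_lt_of_ge (hamax x (by simpa using ⟨c, hlt⟩)))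
  have hK0 : K b a ≠ 0 := Nat.ne_of_gt (Nat.zero_lt_of_lt hb)
  have hab : a < b := hK.isMultiInv b a hK0
  refine ⟨a, b, ⟨⟨hab, fun c hc => ?_⟩, fun y hyb hy => ?_, hb.trans_le (hK.le b a)⟩, hb⟩
  · rw [hbmax c hc, hamax b hab, hK.eq hab hc hK0]
  · have h2 := hy.2 b hyb
    have h3 := hamax y hy.1 b
    have h4 := hK.mono hy.1 hyb
    omega

/-- Only `eq` is at risk, when one rotation makes `(y, x)` nonzero and the other leaves it zero.
Then the other rotation must treat columns `x` and `y` alike in every row `z > y`; `hb` excludes the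
one configuration where it does not. -/
theorem isTamariInv_max (hI : IsTamariInv s I) (h : IsInvAscent s I a b)
    (h' : IsInvAscent s I a' b') (haa : a < a') (hb : b = a' → I b a ≠ 0) :
    IsTamariInv s (fun y x => max (invRot I a b y x) (invRot I a' b' y x)) := by
  have hV := h.isTamariInv_invRot hI
  have hW := h'.isTamariInv_invRot hI
  refine ⟨fun y x h0 => ?_, fun y x => max_le (hV.le y x) (hW.le y x),
    fun x y z hxy hyz => max_le_max (hV.mono hxy hyz) (hW.mono hxy hyz),
    fun x y z hxy hyz h0 => ?_⟩
  · by_cases h1 : invRot I a b y x = 0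
    · exact hW.isMultiInv y x (by simpa [h1] using h0)
    · exact hV.isMultiInv y x h1
  · by_cases hv : invRot I a b y x = 0
    · have hw : invRot I a' b' y x ≠ 0 := by simpa [hv] using h0
      have hi : I y x = 0 := Nat.le_zero.1 (hv ▸ h.le_invRot hI y x)
      obtain ⟨rfl, hm⟩ := (h'.lt_invRot_iff hI (y := y) (x := x)).1
        (by rw [hi]; exact Nat.pos_of_ne_zero hw)
      have h3 := h'.moved_below hI hm hyz
      suffices h4 : invRot I a b z x = invRot I a b z y by simp only [h4, hW.eq hxy hyz hw]
      by_cases hz : z = b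
      · subst hz
        have h4 : ¬ InvMoved I a y := fun e =>
          absurd (hI.moved_le e) (not_le_of_gt (haa.trans h'.below.1))
        have h5 : ¬ InvMoved I a x := fun e => by
          have h6 := h.lt_of_between hI haa (h'.below.1.trans hyz)
          have h7 := h'.below.2 z hyz
          have h8 := hI.moved_eq e h.below.1
          omega
        rw [invRot_of_not fun e => h5 e.2, invRot_of_not fun e => h4 e.2, h3]
      · rw [invRot_of_not fun e => hz e.1, invRot_of_not fun e => hz e.1, h3]
    · by_cases hw : invRot I a' b' y x = 0
      · have hi : I y x = 0 := Nat.le_zero.1 (hw ▸ h'.le_invRot hI y x)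
        obtain ⟨rfl, hm⟩ := (h.lt_invRot_iff hI (y := y) (x := x)).1
          (by rw [hi]; exact Nat.pos_of_ne_zero hv)
        have h3 := h.moved_below hI hm hyz
        suffices h4 : invRot I a' b' z x = invRot I a' b' z y by simp only [h4, hV.eq hxy hyz hv]
        by_cases hz : z = b'
        · subst hz
          have hx := hI.moved_le hm
          -- Here `I y a = I y x = 0`, so `hb` rules out `y = a'`, where `y` would be moved but `x`
          -- would not.
          have hya : y ≠ a' := fun e => hb e (hI.moved_eq hm h.below.1 ▸ hi)
          have h4 : InvMoved I a' x ↔ InvMoved I a' y := by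
            rcases lt_or_gt_of_ne hya with hlt | hlt
            · simp [InvMoved, h.moved_below hI hm hlt, hya, (hx.trans_lt haa).ne]
            · refine iff_of_false (fun e => ?_) fun e =>
                absurd (hI.moved_le e) (not_le_of_gt hlt)
              have h5 := hI.moved_eq e hlt
              have h6 := h.lt_of_between hI haa hlt
              have h7 := hI.moved_eq hm h.below.1
              omega
          simp only [invRot, h4, h3]
        · rw [invRot_of_not fun e => hz e.1, invRot_of_not fun e => hz e.1, h3]
      · simp only [hV.eq hxy hyz hv, hW.eq hxy hyz hw]

end InversionSets

/-! ### Rotations as covers, and the lattice property -/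

namespace TamariTree

variable {n : ℕ} {s : Fin n → ℕ} {T Z K : TamariTree s} {a b x y : Fin n}

theorem isRotation_iff :
    IsRotation T Z a b ↔ IsInvAscent s T.1.inv a b ∧ Z.1.inv = invRot T.1.inv a b := by
  unfold IsRotation
  rw [isAscent_iff]
  exact and_congr_right fun h => h.isTransClosure_iff T.isTamariInv

theorem exists_isRotation (h : IsInvAscent s T.1.inv a b) : ∃ Z, IsRotation T Z a b := by
  obtain ⟨Z, hZ⟩ := exists_inv_eq (h.isTamariInv_invRot T.isTamariInv)
  exact ⟨Z, isRotation_iff.2 ⟨h, hZ⟩⟩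

namespace IsRotation

theorem ascent (h : IsRotation T Z a b) : IsInvAscent s T.1.inv a b := (isRotation_iff.1 h).1

theorem inv_eq (h : IsRotation T Z a b) : Z.1.inv = invRot T.1.inv a b := (isRotation_iff.1 h).2

theorem inv_lt_iff (h : IsRotation T Z a b) :
    T.1.inv y x < Z.1.inv y x ↔ y = b ∧ InvMoved T.1.inv a x := by
  rw [h.inv_eq]
  exact h.ascent.lt_invRot_iff T.isTamariInv

theorem inv_apply (h : IsRotation T Z a b) (y x : Fin n) :
    Z.1.inv y x = if y = b ∧ InvMoved T.1.inv a x then T.1.inv b a + 1 else T.1.inv y x := by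
  rw [h.inv_eq]
  rfl

theorem le (h : IsRotation T Z a b) : T ≤ Z := le_iff.2 fun y x => by
  rw [h.inv_eq]
  exact h.ascent.le_invRot T.isTamariInv y x

theorem inv_root_lt (h : IsRotation T Z a b) : T.1.inv b a < Z.1.inv b a :=
  h.inv_lt_iff.2 ⟨rfl, Or.inl rfl⟩

theorem le_of_row_lt (h : IsRotation T Z a b) (hK : T ≤ K) (hx : x ≤ a)
    (hlt : T.1.inv b a < K.1.inv b x) : Z ≤ K := by
  have h1 : K.1.inv b x ≤ K.1.inv b a := by
    rcases hx.eq_or_lt with rfl | hx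
    · exact le_rfl
    · exact K.isTamariInv.mono hx h.ascent.below.1
  have h2 := h.ascent.invRot_le T.isTamariInv K.isTamariInv.isTransInv (le_iff.1 hK)
    (hlt.trans_le h1)
  rw [← h.inv_eq] at h2
  exact le_iff.2 h2

/-- All raised entries have the same old value `T.1.inv b a`, and row `b` of `K` increases up to
column `a`, so `K` also exceeds `T` at `(b, a)`. -/
theorem le_of_inv_lt (h : IsRotation T Z a b) (hK : T ≤ K) (h1 : T.1.inv y x < Z.1.inv y x)
    (h2 : T.1.inv y x < K.1.inv y x) : Z ≤ K := by
  obtain ⟨rfl, hm⟩ := h.inv_lt_iff.1 h1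
  refine h.le_of_row_lt hK (T.isTamariInv.moved_le hm) ?_
  rwa [← T.isTamariInv.moved_eq hm h.ascent.below.1]

end IsRotation

theorem exists_inv_lt (hle : T ≤ Z) (hne : T ≠ Z) : ∃ y x, T.1.inv y x < Z.1.inv y x := by
  by_contra! h
  exact hne (le_antisymm hle (le_iff.2 h))

theorem exists_isRotation_le (hlt : T < Z) : ∃ a b Q, IsRotation T Q a b ∧ Q ≤ Z := by
  obtain ⟨a, b, h, h'⟩ := exists_isInvAscent_lt Z.isTamariInv (le_iff.1 hlt.le)
    fun e => hlt.ne (ext_inv e)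
  obtain ⟨Q, hQ⟩ := exists_isRotation h
  exact ⟨a, b, Q, hQ, hQ.le_of_row_lt hlt.le le_rfl h'⟩

theorem IsRotation.covBy (h : IsRotation T Z a b) : T ⋖ Z := by
  refine ⟨lt_of_le_of_ne h.le fun e => ?_, fun K hTK hKZ => ?_⟩
  · have := h.inv_root_lt
    rw [e] at this
    exact lt_irrefl _ this
  · obtain ⟨y, x, hyx⟩ := exists_inv_lt hTK.le hTK.ne
    exact absurd (h.le_of_inv_lt hTK.le (hyx.trans_le (le_iff.1 hKZ.le y x)) hyx)
      (not_le_of_gt hKZ)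

theorem exists_isRotation_of_covBy (h : T ⋖ Z) : ∃ a b, IsRotation T Z a b := by
  obtain ⟨a, b, Q, hQ, hle⟩ := exists_isRotation_le h.lt
  rcases hle.eq_or_lt with rfl | hlt
  · exact ⟨a, b, hQ⟩
  · exact absurd hlt (h.2 hQ.covBy.lt)

/-- Determines the label of a cover from the set of changed entries alone, without knowing its
ascent. -/
theorem IsRotation.label_eq (h : IsRotation T Z a b) {b' a' : Fin n}
    (h1 : T.1.inv b' a' < Z.1.inv b' a')
    (h2 : ∀ y x, T.1.inv y x < Z.1.inv y x → x ≤ a') : a = a' :=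
  le_antisymm (h2 _ _ h.inv_root_lt) (T.isTamariInv.moved_le (h.inv_lt_iff.1 h1).2)

theorem IsRotation.unique {a' b' : Fin n} (h : IsRotation T Z a b) (h' : IsRotation T Z a' b') :
    a = a' ∧ b = b' :=
  ⟨h.label_eq h'.inv_root_lt fun _ _ hlt => T.isTamariInv.moved_le (h'.inv_lt_iff.1 hlt).2,
    (h'.inv_lt_iff.1 h.inv_root_lt).1⟩

/-- The vertex `b` is the parent of `a`, hence determined by `a`. -/
theorem IsRotation.eq_of_label_eq {Q : TamariTree s} {b' : Fin n} (h : IsRotation T Z a b)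
    (h' : IsRotation T Q a b') : Z = Q := by
  have hb : b = b' := by
    rcases lt_trichotomy b b' with hlt | rfl | hlt
    · exact (h'.ascent.not_below b hlt h.ascent.below).elim
    · rfl
    · exact (h.ascent.not_below b' hlt h'.ascent.below).elim
  subst hb
  exact ext_inv (h.inv_eq.trans h'.inv_eq.symm)

theorem exists_isGLB {S : Set (TamariTree s)} (hS : S.Nonempty) : ∃ m, IsGLB S m := by
  let f : Fin n → Fin n → Set ℕ := fun y x => (fun T : TamariTree s => T.1.inv y x) '' S
  have hle : ∀ y x, ∀ T ∈ S, sInf (f y x) ≤ T.1.inv y x := fun y x T hT =>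
    Nat.sInf_le (Set.mem_image_of_mem _ hT)
  have hex : ∀ y x, ∃ T ∈ S, T.1.inv y x = sInf (f y x) := fun y x =>
    Nat.sInf_mem (hS.image _)
  have hI : IsTamariInv s (fun y x => sInf (f y x)) := by
    refine ⟨fun y x h0 => ?_, fun y x => ?_, fun a b c hab hbc => ?_, fun a b c hab hbc h0 => ?_⟩
    · obtain ⟨T, -, hT⟩ := hex y x
      exact T.isTamariInv.isMultiInv y x (hT.trans_ne h0)
    · obtain ⟨T, -, hT⟩ := hex y x
      exact hT ▸ T.isTamariInv.le y x
    · obtain ⟨T, hTS, hT⟩ := hex c b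
      exact ((hle c a T hTS).trans (T.isTamariInv.mono hab hbc)).trans_eq hT
    -- A nonzero infimum at `(b, a)` makes that entry nonzero in every member, so columns `a` and
    -- `b` agree in row `c` member by member.
    · refine congrArg sInf (Set.image_congr fun T hT => T.isTamariInv.eq hab hbc ?_)
      exact Nat.ne_of_gt ((Nat.pos_of_ne_zero h0).trans_le (hle b a T hT))
  obtain ⟨m, hm⟩ := exists_inv_eq hI
  refine ⟨m, fun T hT => le_iff.2 fun y x => ?_, fun Z hZ => le_iff.2 fun y x => ?_⟩
  · rw [hm]
    exact hle y x T hT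
  · obtain ⟨T, hTS, hT⟩ := hex y x
    rw [hm]
    exact (le_iff.1 (hZ hTS) y x).trans_eq hT

theorem exists_isTop (s : Fin n → ℕ) : ∃ T : TamariTree s, IsTop T := by
  obtain ⟨T, hT⟩ := exists_inv_eq (s := s) (I := fun y x => if x < y then s y else 0)
    ⟨fun y x h => by by_contra h'; exact h (if_neg h'), fun y x => by split_ifs <;> simp,
      fun a b c hab hbc => by simp [hbc, hab.trans hbc],
      fun a b c hab hbc _ => by simp [hbc, hab.trans hbc]⟩
  refine ⟨T, fun Z => le_iff.2 fun y x => ?_⟩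
  rw [hT]
  by_cases hxy : x < y
  · exact (Z.isTamariInv.le y x).trans_eq (if_pos hxy).symm
  · exact (if_neg hxy : Z.1.inv y x = 0).trans_le (Nat.zero_le _)

theorem isFiniteLattice (s : Fin n → ℕ) : IsFiniteLattice (TamariTree s) where
  nonempty := ⟨(exists_isTop s).choose⟩
  finite := by
    refine Finite.of_injective (fun (T : TamariTree s) (y : Fin n) (x : Fin n) =>
      (⟨T.1.inv y x, Nat.lt_succ_of_le (T.isTamariInv.le y x)⟩ : Fin (s y + 1))) ?_
    intro T Z h
    refine ext_inv (funext fun y => funext fun x => ?_)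
    exact congrArg Fin.val (congrFun (congrFun h y) x)
  exists_join T Z := by
    obtain ⟨m, hm⟩ := exists_isTop s
    obtain ⟨j, hj⟩ := exists_isGLB (S := upperBounds {T, Z}) ⟨m, fun K _ => hm K⟩
    exact ⟨j, isGLB_upperBounds.1 hj⟩
  exists_meet T Z := exists_isGLB ⟨T, by simp⟩

end TamariTree

/-! ### Labels along saturated chains; diamonds and pentagons -/

section Chains

variable {L Λ : Type*} [PartialOrder L]

/-- The set of labels used by any saturated chain from `x` to `y` is `S`. -/
def UsesExactly (lab : EdgeLabeling L Λ) (x y : L) (S : Set Λ) : Prop :=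
  ∀ (k : ℕ) (c : ℕ → L) (hc : ∀ i, i < k → c i ⋖ c (i + 1)), c 0 = x → c k = y →
    ∀ l, l ∈ S ↔ ∃ i, ∃ hi : i < k, lab _ _ (hc i hi) = l

theorem chain_le {k : ℕ} {c : ℕ → L} (hc : ∀ i, i < k → c i ⋖ c (i + 1)) : c 0 ≤ c k := by
  induction k with
  | zero => exact le_rfl
  | succ k ih => exact (ih fun i hi => hc i (hi.trans k.lt_succ_self)).trans (hc k k.lt_succ_self).le

theorem usesExactly_self (lab : EdgeLabeling L Λ) (x : L) : UsesExactly lab x x ∅ := by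
  intro k c hc h0 hk l
  cases k with
  | zero => simp
  | succ k =>
    have h1 := chain_le (c := fun i => c (i + 1)) fun i hi => hc (i + 1) (Nat.succ_lt_succ hi)
    have h2 := (hc 0 k.succ_pos).lt.trans_le h1
    rw [h0, hk] at h2
    exact (lt_irrefl _ h2).elim

/-- Splits off the first cover of a chain, so that label sets can be computed from the top of an
interval downwards. -/
theorem UsesExactly.of_covBy {lab : EdgeLabeling L Λ} {x y : L} {S : Set Λ} (hne : x ≠ y)
    (h : ∀ z (hz : x ⋖ z), z ≤ y → ∃ S', UsesExactly lab z y S' ∧ S = insert (lab x z hz) S') :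
    UsesExactly lab x y S := by
  intro k c hc h0 hk l
  cases k with
  | zero => exact (hne (h0.symm.trans hk)).elim
  | succ k =>
    subst h0
    have hc' : ∀ i, i < k → c (i + 1) ⋖ c (i + 1 + 1) := fun i hi =>
      hc (i + 1) (Nat.succ_lt_succ hi)
    obtain ⟨S', h1, rfl⟩ := h (c 1) (hc 0 k.succ_pos)
      ((chain_le (c := fun i => c (i + 1)) hc').trans_eq hk)
    rw [Set.mem_insert_iff, h1 k (fun i => c (i + 1)) hc' rfl hk l]
    constructor
    · rintro (rfl | ⟨i, hi, rfl⟩)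
      · exact ⟨0, k.succ_pos, rfl⟩
      · exact ⟨i + 1, Nat.succ_lt_succ hi, rfl⟩
    · rintro ⟨i, hi, rfl⟩
      cases i with
      | zero => exact Or.inl rfl
      | succ i => exact Or.inr ⟨i, Nat.lt_of_succ_lt_succ hi, rfl⟩

theorem usesExactly_of_covBy {lab : EdgeLabeling L Λ} {x y : L} (h : x ⋖ y) :
    UsesExactly lab x y {lab x y h} :=
  .of_covBy h.ne fun z hz hzy => by
    obtain rfl : z = y := hzy.eq_of_not_lt (h.2 hz.lt)
    exact ⟨∅, usesExactly_self lab z, by simp⟩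

theorem CovBy.eq_or_eq_of_le {x y z : L} (h : x ⋖ y) (hxz : x ≤ z) (hzy : z ≤ y) :
    z = x ∨ z = y :=
  hxz.eq_or_lt.imp Eq.symm fun h' => hzy.eq_of_not_lt (h.2 h')

theorem CovBy.eq_of_covBy_le {x y z : L} (h : x ⋖ y) (h' : x ⋖ z) (hyz : y ≤ z) : z = y :=
  ((h'.eq_or_eq_of_le h.le hyz).resolve_left h.ne').symm

theorem isDiamond_of_covBy {u v w j : L} (hvw : v ≠ w) (huv : u ⋖ v) (huw : u ⋖ w)
    (hvj : v ⋖ j) (hwj : w ⋖ j) (h : ∀ z, u < z → z ≤ j → v ≤ z ∨ w ≤ z) : IsDiamond u j := by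
  refine ⟨v, w, hvw, Set.ext fun z => ?_, huv, hvj, huw, hwj⟩
  simp only [Set.mem_Icc, Set.mem_insert_iff, Set.mem_singleton_iff]
  constructor
  · rintro ⟨h1, h2⟩
    rcases h1.eq_or_lt with rfl | h1
    · exact Or.inl rfl
    · rcases h z h1 h2 with h3 | h3
      · rcases hvj.eq_or_eq_of_le h3 h2 with rfl | rfl <;> simp
      · rcases hwj.eq_or_eq_of_le h3 h2 with rfl | rfl <;> simp
  · rintro (rfl | rfl | rfl | rfl)
    · exact ⟨le_rfl, huv.le.trans hvj.le⟩
    · exact ⟨huv.le, hvj.le⟩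
    · exact ⟨huw.le, hwj.le⟩
    · exact ⟨huv.le.trans hvj.le, le_rfl⟩

theorem isPentagon_of_covBy {u v w p j : L} (hvw : v ≠ w) (hvp : v ≠ p) (huv : u ⋖ v)
    (huw : u ⋖ w) (hvj : v ⋖ j) (hwp : w ⋖ p) (hpj : p ⋖ j)
    (h : ∀ z, u < z → z ≤ j → v ≤ z ∨ w ≤ z)
    (hw : ∀ z, w < z → z ≤ j → z = j ∨ p ≤ z) : IsPentagon u j := by
  refine ⟨v, w, p, hvw, hvp, Set.ext fun z => ?_, huv, hvj, huw, hwp, hpj⟩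
  simp only [Set.mem_Icc, Set.mem_insert_iff, Set.mem_singleton_iff]
  constructor
  · rintro ⟨h1, h2⟩
    rcases h1.eq_or_lt with rfl | h1
    · exact Or.inl rfl
    · rcases h z h1 h2 with h3 | h3
      · rcases hvj.eq_or_eq_of_le h3 h2 with rfl | rfl <;> simp
      · rcases h3.eq_or_lt with rfl | h3
        · simp
        · rcases hw z h3 h2 with rfl | h3
          · simp
          · rcases hpj.eq_or_eq_of_le h3 h2 with rfl | rfl <;> simp
  · rintro (rfl | rfl | rfl | rfl | rfl)
    · exact ⟨le_rfl, huv.le.trans hvj.le⟩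
    · exact ⟨huv.le, hvj.le⟩
    · exact ⟨huw.le, hwp.le.trans hpj.le⟩
    · exact ⟨huw.le.trans hwp.le, hpj.le⟩
    · exact ⟨huv.le.trans hvj.le, le_rfl⟩

end Chains

/-! ### The interval generated by two rotations -/

namespace TamariTree

variable {n : ℕ} {s : Fin n → ℕ} {u v w j : TamariTree s} {a b a' b' : Fin n}

/-- The edge labeling sends a rotation along `(a, b)` to `a`. -/
def IsRotationLabeling (lab : EdgeLabeling (TamariTree s) (Fin n)) : Prop :=
  ∀ (T Z : TamariTree s) (h : T ⋖ Z) (a b : Fin n), IsRotation T Z a b → lab T Z h = a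

theorem diamond_of_rotations (hv : IsRotation u v a b) (hw : IsRotation u w a' b')
    (haa : a < a') (hb : b = a' → u.1.inv b a ≠ 0) (hj : IsLUB {v, w} j) :
    IsDiamond u j ∧ ∀ lab : EdgeLabeling (TamariTree s) (Fin n), IsRotationLabeling lab →
      UsesExactly lab u j {a, a'} := by
  have hI := u.isTamariInv
  have hvw : v ≠ w := fun e => by
    subst e
    exact haa.ne (hv.unique hw).1
  obtain ⟨m, hm⟩ := exists_inv_eq (isTamariInv_max hI hv.ascent hw.ascent haa hb)
  rw [← hv.inv_eq, ← hw.inv_eq] at hm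
  have hm' : ∀ y x, m.1.inv y x = max (v.1.inv y x) (w.1.inv y x) := fun y x => by rw [hm]
  have hvm : v ≤ m := le_iff.2 fun y x => by rw [hm']; exact le_max_left _ _
  have hwm : w ≤ m := le_iff.2 fun y x => by rw [hm']; exact le_max_right _ _
  have hmax : ∀ k, v ≤ k → w ≤ k → m ≤ k := fun k h1 h2 => le_iff.2 fun y x => by
    rw [hm']; exact max_le (le_iff.1 h1 y x) (le_iff.1 h2 y x)
  obtain rfl : j = m := by
    refine hj.unique ⟨?_, fun k hk => hmax k (hk (by simp)) (hk (by simp))⟩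
    rintro k (rfl | rfl) <;> assumption
  have hvlt : ∀ y x, v.1.inv y x < j.1.inv y x → v.1.inv y x < w.1.inv y x := fun y x h => by
    rw [hm'] at h
    exact (lt_max_iff.1 h).resolve_left (lt_irrefl _)
  have hwlt : ∀ y x, w.1.inv y x < j.1.inv y x → w.1.inv y x < v.1.inv y x := fun y x h => by
    rw [hm'] at h
    exact (lt_max_iff.1 h).resolve_right (lt_irrefl _)
  have hu : ∀ z, u < z → z ≤ j → v ≤ z ∨ w ≤ z := by
    intro z h1 h2
    obtain ⟨y, x, hyx⟩ := exists_inv_lt h1.le h1.ne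
    have h3 := hyx.trans_le (le_iff.1 h2 y x)
    rw [hm', lt_max_iff] at h3
    exact h3.imp (fun h => hv.le_of_inv_lt h1.le h hyx) (fun h => hw.le_of_inv_lt h1.le h hyx)
  -- An element strictly above `v` and below `j` exceeds `v` at an entry raised by the other
  -- rotation, hence lies above `w`, and so above `j`.
  have hvj : v ⋖ j := by
    refine ⟨lt_of_le_of_ne hvm fun e => hvw ?_, fun z h1 h2 => ?_⟩
    · exact hw.covBy.eq_of_covBy_le hv.covBy (hwm.trans_eq e.symm)
    · obtain ⟨y, x, hyx⟩ := exists_inv_lt h1.le h1.ne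
      have h3 := hvlt y x (hyx.trans_le (le_iff.1 h2.le y x))
      have h4 := le_iff.1 hv.le y x
      exact absurd (hmax z h1.le (hw.le_of_inv_lt (hv.le.trans h1.le) (h4.trans_lt h3)
        (h4.trans_lt hyx))) (not_le_of_gt h2)
  have hwj : w ⋖ j := by
    refine ⟨lt_of_le_of_ne hwm fun e => hvw ?_, fun z h1 h2 => ?_⟩
    · exact (hv.covBy.eq_of_covBy_le hw.covBy (hvm.trans_eq e.symm)).symm
    · obtain ⟨y, x, hyx⟩ := exists_inv_lt h1.le h1.ne
      have h3 := hwlt y x (hyx.trans_le (le_iff.1 h2.le y x))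
      have h4 := le_iff.1 hw.le y x
      exact absurd (hmax z (hv.le_of_inv_lt (hw.le.trans h1.le) (h4.trans_lt h3)
        (h4.trans_lt hyx)) h1.le) (not_le_of_gt h2)
  refine ⟨isDiamond_of_covBy hvw hv.covBy hw.covBy hvj hwj hu, fun lab hlab => ?_⟩
  have hlv : lab v j hvj = a' := by
    obtain ⟨α, β, hr⟩ := exists_isRotation_of_covBy hvj
    refine (hlab _ _ hvj α β hr).trans (hr.label_eq (b' := b') ?_ fun y x h => ?_)
    · rw [hm', lt_max_iff, hv.inv_apply,
        if_neg fun e => absurd (hI.moved_le e.2) (not_le_of_gt haa)]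
      exact Or.inr hw.inv_root_lt
    · exact hI.moved_le (hw.inv_lt_iff.1 ((le_iff.1 hv.le y x).trans_lt (hvlt y x h))).2
  have hlw : lab w j hwj = a := by
    obtain ⟨α, β, hr⟩ := exists_isRotation_of_covBy hwj
    refine (hlab _ _ hwj α β hr).trans (hr.label_eq (b' := b) ?_ fun y x h => ?_)
    · rw [hm', lt_max_iff, hw.inv_apply, if_neg]
      · exact Or.inl hv.inv_root_lt
      · rintro ⟨rfl, e⟩
        have h1 := hv.ascent.lt_of_between hI haa hw.ascent.below.1
        rw [hI.moved_eq e hw.ascent.below.1] at h1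
        exact lt_irrefl _ h1
    · exact hI.moved_le (hv.inv_lt_iff.1 ((le_iff.1 hw.le y x).trans_lt (hwlt y x h))).2
  refine .of_covBy (hv.covBy.lt.trans hvj.lt).ne fun z hz hzj => ?_
  rcases hu z hz.lt hzj with h1 | h1
  · obtain rfl := hv.covBy.eq_of_covBy_le hz h1
    refine ⟨_, usesExactly_of_covBy hvj, ?_⟩
    rw [hlv, hlab _ _ _ _ _ hv]
  · obtain rfl := hw.covBy.eq_of_covBy_le hz h1
    refine ⟨_, usesExactly_of_covBy hwj, ?_⟩
    rw [hlw, hlab _ _ _ _ _ hw, Set.pair_comm]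

/-- In `v`, `a` has moved to child 1 of `b`, so rotating `b` along `d` takes it along and reaches
the join. In `w`, `b` has moved without its child 0, and `a` is left as a child of `d`; rotating
along `(a, d)` returns it to child 0 of `b`, and rotating along `(a, b)` finishes. -/
theorem pentagon_of_rotations {d : Fin n} (hv : IsRotation u v a b) (hw : IsRotation u w b d)
    (h0 : u.1.inv b a = 0) (hj : IsLUB {v, w} j) :
    IsPentagon u j ∧ ∀ lab : EdgeLabeling (TamariTree s) (Fin n), IsRotationLabeling lab →
      UsesExactly lab u j {a, b} := by
  have hI := u.isTamariInv
  have hab := hv.ascent.below.1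
  have hbd := hw.ascent.below.1
  have hvw : v ≠ w := fun e => by
    subst e
    exact hab.ne (hv.unique hw).1
  have hv' : ∀ y x, y ≠ b → v.1.inv y x = u.1.inv y x := fun y x h => by
    rw [hv.inv_apply, if_neg fun e => h e.1]
  have hw' : ∀ y x, y ≠ d → w.1.inv y x = u.1.inv y x := fun y x h => by
    rw [hw.inv_apply, if_neg fun e => h e.1]
  have hda : u.1.inv d a = u.1.inv d b := hv.ascent.below.2 d hbd
  have hwda : w.1.inv d a = u.1.inv d a := by
    rw [hw.inv_apply, if_neg]
    rintro ⟨-, h | h⟩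
    · exact hab.ne h
    · exact h h0
  have hwdb : w.1.inv d b = u.1.inv d a + 1 := by
    rw [hw.inv_apply, if_pos ⟨rfl, Or.inl rfl⟩, hda]
  obtain ⟨m, hm⟩ : ∃ m, IsRotation v m b d := by
    refine exists_isRotation ⟨⟨hbd, fun c hc => ?_⟩, fun y hy h => ?_, ?_⟩
    · rw [hv' c _ (hbd.trans hc).ne', hv' c _ (hbd.trans hc).ne', hw.ascent.below.2 c hc]
    · refine hw.ascent.not_below y hy ⟨h.1, fun c hc => ?_⟩
      have := h.2 c hc
      rwa [hv' c _ (h.1.trans hc).ne', hv' c _ (h.1.trans hc).ne'] at this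
    · rw [hv' d _ hbd.ne']
      exact hw.ascent.lt
  obtain ⟨p, hp⟩ : ∃ p, IsRotation w p a d := by
    refine exists_isRotation ⟨⟨hab.trans hbd, fun c hc => ?_⟩, fun y hy h => ?_, ?_⟩
    · rw [hw' c _ hc.ne', hw' c _ hc.ne', ← hw.ascent.below.2 c hc,
        hv.ascent.below.2 c (hbd.trans hc)]
    · have h1 := h.2 d hy
      rw [hwda] at h1
      have h2 := hI.mono h.1 hy
      have h3 := le_iff.1 hw.le d y
      -- In `w` no `y < d` is an ancestor of `a`: for `y < b` it would be one in `u` already, while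
      -- for `y ≥ b` row `d` of `w` separates it from `a`.
      rcases lt_trichotomy y b with hyb | rfl | hyb
      · refine hv.ascent.not_below y hyb ⟨h.1, fun c hc => ?_⟩
        by_cases hcd : c = d
        · subst hcd
          exact le_antisymm h2 (h3.trans h1.ge)
        · have := h.2 c hc
          rwa [hw' c _ hcd, hw' c _ hcd] at this
      · omega
      · have := hw.ascent.lt_of_between hI hyb hy
        omega
    · rw [hwda, hda]
      exact hw.ascent.lt
  have hpd : p.1.inv d a = p.1.inv d b := by
    have h1 := p.isTamariInv.mono hab hbd
    have h2 := hp.inv_apply d b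
    have h3 : p.1.inv d a = w.1.inv d a + 1 := by
      rw [hp.inv_apply, if_pos ⟨rfl, Or.inl rfl⟩]
    split_ifs at h2 <;> omega
  have hp' : ∀ y x, y ≠ d → p.1.inv y x = u.1.inv y x := fun y x h => by
    rw [hp.inv_apply, if_neg fun e => h e.1, hw' y x h]
  have hpm : IsRotation p m a b := by
    refine isRotation_iff.2 ⟨⟨⟨hab, fun c hc => ?_⟩, fun y hy h => ?_, ?_⟩, ?_⟩
    · by_cases hcd : c = d
      · rw [hcd, hpd]
      · rw [hp' c _ hcd, hp' c _ hcd, hv.ascent.below.2 c hc]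
    · refine hv.ascent.not_below y hy ⟨h.1, fun c hc => ?_⟩
      by_cases hcd : c = d
      · subst hcd
        have h1 := hI.mono h.1 (hy.trans hbd)
        have h2 := hI.mono hy hbd
        omega
      · have := h.2 c hc
        rwa [hp' c _ hcd, hp' c _ hcd] at this
    · rw [hp' b _ hbd.ne]
      exact hv.ascent.lt
    -- Both routes raise row `b` at the columns moved by `a`, and row `d` at those moved by `a` or
    -- `b`.
    · funext y x
      have hbd' := hbd.ne
      have had' := (hab.trans hbd).ne
      have hab' := hab.ne
      have e1 := hm.inv_apply y x
      have e2 := hv.inv_apply y x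
      have e3 := hv.inv_apply b x
      have e4 := hv' d b hbd.ne'
      have e5 := hp.inv_apply y x
      have e6 := hw.inv_apply y x
      have e7 := hw' a x had'
      have e8 := hp' a x had'
      have e9 := hp' b a hbd.ne
      unfold invRot
      simp only [InvMoved] at *
      grind
  have hvm := hm.covBy
  have hwp := hp.covBy
  have hpm' := hpm.covBy
  have hmax : ∀ k, v ≤ k → u.1.inv d a < k.1.inv d b → m ≤ k := fun k h1 h2 => by
    refine hm.le_of_row_lt h1 le_rfl ?_
    rwa [hv' d _ hbd.ne', ← hda]
  obtain rfl : j = m := by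
    refine hj.unique ⟨?_, fun k hk => hmax k (hk (by simp)) ?_⟩
    · rintro k (rfl | rfl)
      · exact hvm.le
      · exact hwp.le.trans hpm'.le
    · have := le_iff.1 (hk (show w ∈ {v, w} by simp)) d b
      omega
  have hjrow : ∀ y x, u.1.inv y x < j.1.inv y x →
      u.1.inv y x < v.1.inv y x ∨ y = d ∧ (InvMoved u.1.inv b x ∨ InvMoved u.1.inv a x) := by
    intro y x h
    have e1 := hm.inv_apply y x
    have e3 := hv.inv_apply b x
    simp only [InvMoved] at *
    grind
  have hxle : ∀ x, InvMoved u.1.inv b x ∨ InvMoved u.1.inv a x → x ≤ b := fun x h =>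
    h.elim hI.moved_le fun h' => (hI.moved_le h').trans hab.le
  have hu : ∀ z, u < z → z ≤ j → v ≤ z ∨ w ≤ z := by
    intro z h1 h2
    obtain ⟨y, x, hyx⟩ := exists_inv_lt h1.le h1.ne
    rcases hjrow y x (hyx.trans_le (le_iff.1 h2 y x)) with h3 | ⟨rfl, h3⟩
    · exact Or.inl (hv.le_of_inv_lt h1.le h3 hyx)
    · refine Or.inr (hw.le_of_row_lt h1.le (hxle x h3) ?_)
      have h4 : u.1.inv y x = u.1.inv y b := h3.elim (fun h => hI.moved_eq h hbd) fun h =>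
        (hI.moved_eq h (hab.trans hbd)).trans hda
      rwa [← h4]
  have hwz : ∀ z, w < z → z ≤ j → z = j ∨ p ≤ z := by
    intro z h1 h2
    obtain ⟨y, x, hyx⟩ := exists_inv_lt h1.le h1.ne
    have h3 := le_iff.1 hw.le y x
    rcases hjrow y x ((h3.trans_lt hyx).trans_le (le_iff.1 h2 y x)) with h4 | ⟨rfl, h4⟩
    · refine Or.inl (le_antisymm h2 (hmax z ?_ ?_))
      · exact hv.le_of_inv_lt (hw.le.trans h1.le) h4 (h3.trans_lt hyx)
      · have := le_iff.1 h1.le d b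
        omega
    -- At columns moved by `b`, row `d` of `w` already has its value in `j`, so `z` cannot exceed
    -- it.
    · have h5 : ¬ InvMoved u.1.inv b x := fun h => by
        have e1 := hw.inv_apply y x
        rw [if_pos ⟨rfl, h⟩] at e1
        have e2 := le_iff.1 h2 y x
        have e3 := hm.inv_apply y x
        have e4 := hv' y b hbd.ne'
        have e5 := hI.moved_eq h hbd
        have e6 := hv' y x hbd.ne'
        split_ifs at e3 <;> omega
      have h6 := h4.resolve_left h5
      refine Or.inr (hp.le_of_row_lt h1.le (hI.moved_le h6) ?_)
      have h7 := hI.moved_eq h6 (hab.trans hbd)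
      omega
  have hvp : v ≠ p := fun e => by
    have h1 := le_iff.1 (hwp.le.trans_eq e.symm) d b
    rw [hv' d _ hbd.ne'] at h1
    omega
  refine ⟨isPentagon_of_covBy hvw hvp hv.covBy hw.covBy hvm hwp hpm' hu hwz, fun lab hlab => ?_⟩
  -- The only chain from `w` to `j` passes through `p`, and both of its steps have label `a`.
  have hUw : UsesExactly lab w j {a} := by
    refine .of_covBy (hwp.lt.trans hpm'.lt).ne fun z hz hzj => ?_
    obtain rfl : z = p := by
      rcases hwz z hz.lt hzj with rfl | h1
      · exact absurd hpm'.lt (hz.2 hwp.lt)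
      · exact hwp.eq_of_covBy_le hz h1
    refine ⟨_, usesExactly_of_covBy hpm', ?_⟩
    rw [hlab _ _ _ _ _ hpm, hlab _ _ _ _ _ hp, Set.pair_eq_singleton]
  refine .of_covBy (hv.covBy.lt.trans hvm.lt).ne fun z hz hzj => ?_
  rcases hu z hz.lt hzj with h1 | h1
  · obtain rfl := hv.covBy.eq_of_covBy_le hz h1
    refine ⟨_, usesExactly_of_covBy hvm, ?_⟩
    rw [hlab _ _ _ _ _ hm, hlab _ _ _ _ _ hv]
  · obtain rfl := hw.covBy.eq_of_covBy_le hz h1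
    refine ⟨_, hUw, ?_⟩
    rw [hlab _ _ _ _ _ hw, Set.pair_comm]

theorem interval_of_rotations_of_lt (hv : IsRotation u v a b) (hw : IsRotation u w a' b')
    (haa : a < a') (hj : IsLUB {v, w} j) :
    (IsDiamond u j ∨ IsPentagon u j) ∧ ∀ lab : EdgeLabeling (TamariTree s) (Fin n),
      IsRotationLabeling lab → UsesExactly lab u j {a, a'} := by
  by_cases hb : b = a' → u.1.inv b a ≠ 0
  · exact (diamond_of_rotations hv hw haa hb hj).imp_left Or.inl
  · push Not at hb
    obtain ⟨rfl, h0⟩ := hb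
    exact (pentagon_of_rotations hv hw h0 hj).imp_left Or.inr

theorem interval_of_rotations (hv : IsRotation u v a b) (hw : IsRotation u w a' b')
    (hvw : v ≠ w) (hj : IsLUB {v, w} j) :
    (IsDiamond u j ∨ IsPentagon u j) ∧ ∀ lab : EdgeLabeling (TamariTree s) (Fin n),
      IsRotationLabeling lab → UsesExactly lab u j {a, a'} := by
  rcases lt_trichotomy a a' with h | rfl | h
  · exact interval_of_rotations_of_lt hv hw h hj
  · exact (hvw (hv.eq_of_label_eq hw)).elim
  · rw [Set.pair_comm] at hj ⊢
    exact interval_of_rotations_of_lt hw hv h hj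

theorem IsRotationLabeling.isSBLabeling {lab : EdgeLabeling (TamariTree s) (Fin n)}
    (hlab : IsRotationLabeling lab) : IsSBLabeling lab := by
  have key : ∀ (u v w : TamariTree s) (hv : u ⋖ v) (hw : u ⋖ w), v ≠ w → ∀ j,
      IsLUB {v, w} j → UsesExactly lab u j {lab u v hv, lab u w hw} := by
    intro u v w hv hw hvw j hj
    obtain ⟨a, b, hva⟩ := exists_isRotation_of_covBy hv
    obtain ⟨a', b', hwa⟩ := exists_isRotation_of_covBy hw
    rw [hlab _ _ hv _ _ hva, hlab _ _ hw _ _ hwa]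
    exact (interval_of_rotations hva hwa hvw hj).2 lab hlab
  refine ⟨isFiniteLattice s, fun u v w hv hw hvw he => ?_, ?_, ?_⟩
  · obtain ⟨a, b, hva⟩ := exists_isRotation_of_covBy hv
    obtain ⟨a', b', hwa⟩ := exists_isRotation_of_covBy hw
    rw [hlab _ _ hv _ _ hva, hlab _ _ hw _ _ hwa] at he
    subst he
    exact hvw (hva.eq_of_label_eq hwa)
  · intro u v w hv hw hvw j hj k c hc h0 hk
    have h := key u v w hv hw hvw j hj k c hc h0 hk
    exact ⟨(h _).1 (by simp), (h _).1 (by simp)⟩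
  · intro u v w hv hw hvw j hj k c hc h0 hk i hi
    exact (key u v w hv hw hvw j hj k c hc h0 hk _).2 ⟨i, hi, rfl⟩

end TamariTree

theorem mainTheorem2 {n : ℕ} (s : Fin n → ℕ) :
    (∀ T Z : TamariTree s, T ⋖ Z →
      ∃! p : Fin n × Fin n, TamariTree.IsRotation T Z p.1 p.2) ∧
    (∃ lab : EdgeLabeling (TamariTree s) (Fin n),
      (∀ (T Z : TamariTree s) (h : T ⋖ Z) (a b : Fin n),
        TamariTree.IsRotation T Z a b → lab T Z h = a) ∧
      IsSBLabeling lab) ∧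
    (∀ T Z Q J : TamariTree s, T ⋖ Z → T ⋖ Q → Z ≠ Q → IsLUB {Z, Q} J →
      IsDiamond T J ∨ IsPentagon T J) := by
  refine ⟨fun T Z h => ?_, ?_, fun T Z Q J hZ hQ hne hJ => ?_⟩
  · obtain ⟨a, b, hab⟩ := TamariTree.exists_isRotation_of_covBy h
    refine ⟨(a, b), hab, fun p hp => ?_⟩
    obtain ⟨h1, h2⟩ := TamariTree.IsRotation.unique hp hab
    exact Prod.ext h1 h2
  -- The chosen ascent is the only one, so the choice does not matter.
  · have hlab : TamariTree.IsRotationLabeling (s := s)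
        (fun T Z h => (TamariTree.exists_isRotation_of_covBy h).choose) := fun T Z h a b hab =>
      ((TamariTree.exists_isRotation_of_covBy h).choose_spec.choose_spec.unique hab).1
    exact ⟨_, hlab, hlab.isSBLabeling⟩
  · obtain ⟨a, b, hab⟩ := TamariTree.exists_isRotation_of_covBy hZ
    obtain ⟨a', b', hab'⟩ := TamariTree.exists_isRotation_of_covBy hQ
    exact (TamariTree.interval_of_rotations hab hab' hne hJ).1
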